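/- Let $d\ge 2$, $1\le n_0\le n$ and $\tilde n\ge 1$ be integers, let $0<\epsilon\le\frac12$, $\alpha\in(0,1)$, put $\sigma=(n_0d)^{1/4}$, and let $\mu\in\mathbb R^d$ satisfy $\|\mu\|_2^2=d$. Under $P_\mu$ the label $y$ is uniform on $\{-1,1\}$ and $x\mid y\sim\mathcal N(y\mu,\sigma^2 I)$. For $\theta\in\mathbb R^d$ let $f_\theta(x)=\mathrm{sign}(\theta^\top x)\in\{-1,1\}$ (with $\mathrm{sign}(0)=1$), and let its $\ell_\infty$ robust error be $$\mathsf{err}^{\epsilon}_\mu(f_\theta)=\mathbb P_{(x,y)\sim P_\mu}\bigl(\exists x'\in\mathbb R^d:\ \|x'-x\|_\infty\le\epsilon,\ f_\theta(x')\ne y\bigr).$$ Self-training receives $n$ labeled examples $(x_1,y_1),\dots,(x_n,y_n)$ drawn i.i.d. from $P_\mu$ and, independently of them, $\tilde n$ mutually independent unlabeled inputs $\tilde x_1,\dots,\tilde x_{\tilde n}$, of which exactly $\alpha\tilde n$ (an integer) are relevant, i.e. distributed as the $x$-marginal of $P_\mu$, while the remaining $(1-\alpha)\tilde n$ are irrelevant,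 i.e. distributed as $\mathcal N(0,\sigma^2I)$. It forms $\hat\theta=\frac1n\sum_{i=1}^n y_ix_i$, the pseudo-labels $\tilde y_i=f_{\hat\theta}(\tilde x_i)$, and outputs $\hat\theta_{\mathrm{final}}=\frac1{\tilde n}\sum_{i=1}^{\tilde n}\tilde y_i\tilde x_i$. **Theorem.** There exist numerical constants $c>0$ and $r>0$ such that for all $d,n_0,n,\tilde n,\epsilon,\alpha$ as above with $\min\{\epsilon^2/\log d,\ \alpha^2\}\sqrt{d/n_0}>r$ the following holds. 1. For every $\mu\in\mathbb R^d$ with $\|\mu\|_2^2=d$: if $\tilde n\ge n_0\cdot\frac{288\,\epsilon^2}{\alpha^2}\sqrt{d/n_0}$, then $\mathbb E\,\mathsf{err}^{\epsilon}_\mu(f_{\hat\theta_{\mathrm{final}}})\le 10^{-3}$. 2. For $\mu=(1,\dots,1)\in\mathbb R^d$ (which satisfies $\|\mu\|_2^2=d$): if $\tilde n\le n_0\cdot\frac{c\,\epsilon^2}{\alpha^2}\sqrt{d/n_0}$, then $\mathbb E\,\mathsf{err}^{\epsilon}_\mu(f_{\hat\theta_{\mathrm{final}}})\ge\frac12\left(1-\frac1d\right)$.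 In both parts the expectation is over the labeled and unlabeled samples. -/

import Mathlib

open MeasureTheory ProbabilityTheory
open scoped ENNReal

noncomputable section

namespace SelfTraining

/-- The Gaussian law `N(v, σ² I)` on `ℝ^d`. -/
def isoGaussian {d : ℕ} (v : EuclideanSpace ℝ (Fin d)) (σ : ℝ) :
    Measure (EuclideanSpace ℝ (Fin d)) :=
  multivariateGaussian v (σ ^ 2 • (1 : Matrix (Fin d) (Fin d) ℝ))

/-- The joint law of `(x, y)`: the label `y` is uniform on `{-1, 1}`, and given `y` the input `x`
has law `N(y μ, σ² I)`. -/
def dataLaw {d : ℕ} (μ : EuclideanSpace ℝ (Fin d)) (σ : ℝ) :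
    Measure (EuclideanSpace ℝ (Fin d) × ℝ) :=
  (2⁻¹ : ℝ≥0∞) • (isoGaussian μ σ).prod (Measure.dirac 1) +
    (2⁻¹ : ℝ≥0∞) • (isoGaussian (-μ) σ).prod (Measure.dirac (-1))

/-- The linear classifier `x ↦ sign (θᵀ x)` with values in `{-1, 1}` (ties are sent to `1`). -/
def linearClassifier {d : ℕ} (θ x : EuclideanSpace ℝ (Fin d)) : ℝ :=
  if 0 ≤ inner ℝ θ x then 1 else -1

/-- The `ℓ_∞` robust error of a classifier `f`: the probability, over a fresh pair `(x, y)`, that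
some `x'` with `‖x' - x‖_∞ ≤ ε` satisfies `f x' ≠ y`. -/
def robustError {d : ℕ} (μ : EuclideanSpace ℝ (Fin d)) (σ ε : ℝ)
    (f : EuclideanSpace ℝ (Fin d) → ℝ) : ℝ≥0∞ :=
  dataLaw μ σ {p | ∃ x' : EuclideanSpace ℝ (Fin d), (∀ j, |x' j - p.1 j| ≤ ε) ∧ f x' ≠ p.2}

/-- The supervised learning rule `(1/n) ∑ yᵢ xᵢ`. -/
def supervisedEstimator {d n : ℕ} (s : Fin n → EuclideanSpace ℝ (Fin d) × ℝ) :
    EuclideanSpace ℝ (Fin d) :=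
  (n : ℝ)⁻¹ • ∑ i, (s i).2 • (s i).1

/-- The self-training estimator: pseudo-label the unlabeled inputs `u` with the classifier learned
from the labeled sample `s`, then apply the supervised rule to the pseudo-labeled inputs. -/
def selfTrainingEstimator {d n m : ℕ} (s : Fin n → EuclideanSpace ℝ (Fin d) × ℝ)
    (u : Fin m → EuclideanSpace ℝ (Fin d)) : EuclideanSpace ℝ (Fin d) :=
  supervisedEstimator fun i => (u i, linearClassifier (supervisedEstimator s) (u i))

/-- The law of `n` i.i.d. labeled examples. -/
def labeledLaw {d : ℕ} (μ : EuclideanSpace ℝ (Fin d)) (σ : ℝ) (n : ℕ) :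
    Measure (Fin n → EuclideanSpace ℝ (Fin d) × ℝ) :=
  Measure.pi fun _ => dataLaw μ σ

/-- The law of `m` independent unlabeled inputs. Those with index in `S` are relevant, i.e. they
follow the `x`-marginal of the data distribution; the others are drawn from `N(0, σ² I)`. -/
def unlabeledLaw {d m : ℕ} (μ : EuclideanSpace ℝ (Fin d)) (σ : ℝ) (S : Finset (Fin m)) :
    Measure (Fin m → EuclideanSpace ℝ (Fin d)) :=
  Measure.pi fun i => if i ∈ S then (dataLaw μ σ).fst else isoGaussian 0 σ

/-- The expectation, over independent labeled and unlabeled samples, of the robust error of the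
linear classifier found by self-training. -/
def expectedRobustError {d m : ℕ} (μ : EuclideanSpace ℝ (Fin d)) (σ ε : ℝ) (n : ℕ)
    (S : Finset (Fin m)) : ℝ≥0∞ :=
  ∫⁻ z, robustError μ σ ε (linearClassifier (selfTrainingEstimator z.1 z.2))
    ∂((labeledLaw μ σ n).prod (unlabeledLaw μ σ S))

/-- The all-ones vector in `ℝ^d`. -/
def allOnes (d : ℕ) : EuclideanSpace ℝ (Fin d) := WithLp.toLp 2 fun _ => 1

end SelfTraining

end

noncomputable section

namespace SelfTraining

variable {d : ℕ}

/-! ### Moments of the standard Gaussian -/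

/-! Fix the first-stage estimator θ and put u = θ/‖θ‖. Split each unlabeled input as yμ + zu + (w
minus its u-component), with y = ±1 if relevant, y = 0 if irrelevant, and z, w independent Gaussian
noise. The pseudo-label sees only (y, z). Flipping signs of the w's by functions of (y, z) does not
change their joint law, so the final estimator is bμ + Au + perp u g, where b averages pseudo-label
times label, A averages pseudo-label times z, and g ~ N(0, L²I) with L = σ/√m is independent of (b,
A) (`unlabeledLaw_map`).

For a linear classifier θ, an ℓ∞ attack shifts the score by at most ε‖θ‖₁, and this is attained; the
error is thus governed by ⟨θ, μ⟩ against ε‖θ‖₁, up to noise of order σ‖θ‖ (`robustError_le`,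
`le_robustError`). Always |b| ≤ α. If ⟨u, μ⟩ ≥ σ/2, which `supervised_direction` makes likely, then
b ≥ α/4 with high probability. The A-term is negligible on both sides.

Upper bound: the margin is about bd, while ε‖θ‖₁ ≤ ε√d‖θ‖ is at most about εd(b + √2 L). As ε ≤ 1/2,
it is enough that εL is a small multiple of α, i.e. m ≳ ε²σ²/α² (`large_margin`). Lower bound: ‖g‖₁
is of order dL and dominates ‖θ‖₁, so when α is at most a small multiple of εL the attack beats a
margin of at most about αd (`small_margin`).

Every probabilistic estimate is Chebyshev or Markov, with fixed constants as failure budget. -/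

lemma memLp_pow_gaussianReal (k : ℕ) (p : ℕ) (v : NNReal) :
    MemLp (fun x : ℝ => x ^ k) p (gaussianReal 0 v) := by
  rcases Nat.eq_zero_or_pos p with rfl | hp
  · simpa using (by fun_prop : AEStronglyMeasurable (fun x : ℝ => x ^ k) (gaussianReal 0 v))
  have h := memLp_id_gaussianReal (μ := 0) (v := v) ((k * p : ℕ) : NNReal)
  rcases Nat.eq_zero_or_pos k with rfl | hk
  · simpa using memLp_const (1 : ℝ)
  rw [← integrable_norm_rpow_iff (by fun_prop) (by simpa using hp.ne') (by simp)]
  rw [← integrable_norm_rpow_iff (by fun_prop) (by simp; omega)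
    (by simpa using ENNReal.mul_ne_top (by simp) (by simp))] at h
  convert h using 2 with x
  simp [Real.rpow_natCast]
  norm_cast
  rw [pow_mul]

lemma integrable_pow_gaussianReal (k : ℕ) (v : NNReal) :
    Integrable (fun x : ℝ => x ^ k) (gaussianReal 0 v) := by
  rw [← memLp_one_iff_integrable]
  simpa using (memLp_pow_gaussianReal k 1 v)

lemma integral_pow_eq_iteratedDeriv (k : ℕ) :
    ∫ x, x ^ k ∂(gaussianReal 0 1) = iteratedDeriv k (fun t : ℝ => Real.exp (t ^ 2 / 2)) 0 := by
  have h := iteratedDeriv_mgf_zero (X := id) (μ := gaussianReal 0 1) (by simp) k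
  rw [mgf_id_gaussianReal] at h
  simpa using h.symm

lemma iteratedDeriv_four_exp_sq :
    iteratedDeriv 4 (fun t : ℝ => Real.exp (t ^ 2 / 2)) 0 = 3 := by
  -- Differentiation acts on the polynomial factor by p ↦ p' + pX; four steps from 1 give a
  -- polynomial with constant term 3.
  have key : ∀ p : Polynomial ℝ, deriv (fun t : ℝ => p.eval t * Real.exp (t ^ 2 / 2)) =
      fun t => (p.derivative + p * Polynomial.X).eval t * Real.exp (t ^ 2 / 2) := by
    intro p
    funext t
    have h1 : HasDerivAt (fun t : ℝ => t ^ 2 / 2) t t := by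
      simpa using ((hasDerivAt_id t).pow 2).div_const 2
    refine ((p.hasDerivAt t).mul h1.exp).deriv.trans ?_
    simp
    ring
  have e0 : (fun t : ℝ => Real.exp (t ^ 2 / 2)) =
      fun t => (1 : Polynomial ℝ).eval t * Real.exp (t ^ 2 / 2) := by simp
  rw [iteratedDeriv_eq_iterate]
  simp only [Function.iterate_succ, Function.iterate_zero, Function.comp, id]
  rw [e0, key, key, key, key]
  simp
  norm_num

lemma integral_sq_gaussianReal (v : NNReal) : ∫ x, x ^ 2 ∂(gaussianReal 0 v) = v := by
  have := variance_id_gaussianReal (μ := 0) (v := v)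
  rw [variance_of_integral_eq_zero (by fun_prop) (by simp)] at this
  simpa using this

lemma integral_pow_four_gaussianReal : ∫ x, x ^ 4 ∂(gaussianReal 0 1) = 3 := by
  rw [integral_pow_eq_iteratedDeriv, iteratedDeriv_four_exp_sq]

lemma variance_sq_gaussianReal : Var[fun x => x ^ 2; gaussianReal 0 1] = 2 := by
  rw [variance_eq_sub (by simpa using memLp_pow_gaussianReal 2 2 1)]
  have : (fun x : ℝ => x ^ 2) ^ 2 = fun x => x ^ 4 := by funext x; simp; ring
  rw [this, integral_pow_four_gaussianReal, integral_sq_gaussianReal]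
  norm_num

lemma memLp_abs_gaussianReal (v : NNReal) : MemLp (fun x => |x|) 2 (gaussianReal 0 v) := by
  have h : MemLp (fun x : ℝ => x) 2 (gaussianReal 0 v) := by
    simpa using memLp_pow_gaussianReal 1 2 v
  exact h.abs

lemma le_integral_abs_gaussianReal : 5 / 9 ≤ ∫ x, |x| ∂(gaussianReal 0 1) := by
  -- The difference of the two sides is (4/27)|x|(|x| - 3/2)²(|x| + 3). Moments 1 and 3 then give 1
  -- - 12/27 = 5/9.
  have h : ∀ x : ℝ, x ^ 2 - 4 / 27 * x ^ 4 ≤ |x| := by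
    intro x
    have h0 := abs_nonneg x
    rw [← sq_abs x, show x ^ 4 = |x| ^ 4 by rw [← abs_pow, abs_of_nonneg (by positivity)]]
    nlinarith [mul_nonneg h0 (mul_nonneg (sq_nonneg (|x| - 3 / 2)) (by positivity : 0 ≤ |x| + 3))]
  have h2 := (integrable_pow_gaussianReal 4 1).const_mul (4 / 27)
  calc (5 / 9 : ℝ) = ∫ x, (x ^ 2 - 4 / 27 * x ^ 4) ∂(gaussianReal 0 1) := by
        rw [integral_sub (integrable_pow_gaussianReal 2 1) h2, integral_const_mul,
          integral_pow_four_gaussianReal, integral_sq_gaussianReal]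
        norm_num
    _ ≤ _ := integral_mono ((integrable_pow_gaussianReal 2 1).sub h2)
        ((memLp_abs_gaussianReal 1).integrable (by norm_num)) h

lemma variance_abs_gaussianReal_le : Var[fun x => |x|; gaussianReal 0 1] ≤ 1 := by
  refine (variance_le_expectation_sq (by fun_prop)).trans ?_
  simp [integral_sq_gaussianReal]

/-! ### Chebyshev's inequality for sums of independent variables -/

lemma chebyshev_sum_pi {ι : Type*} [Fintype ι] {Ω : ι → Type*} {mΩ : ∀ i, MeasurableSpace (Ω i)}
    {μ : (i : ι) → Measure (Ω i)} [∀ i, IsProbabilityMeasure (μ i)] {X : Π i, Ω i → ℝ}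
    (hX : ∀ i, MemLp (X i) 2 (μ i)) {t : ℝ} (ht : 0 < t) {V : ℝ} (hV : ∑ i, Var[X i; μ i] ≤ V) :
    (Measure.pi μ).real {ω | t ≤ |∑ i, X i (ω i) - ∑ i, ∫ x, X i x ∂(μ i)|} ≤ V / t ^ 2 := by
  have hX' : ∀ i, MemLp (fun ω : ∀ i, Ω i => X i (ω i)) 2 (Measure.pi μ) :=
    fun i => (hX i).comp_measurePreserving (measurePreserving_eval _ i)
  have hs : MemLp (∑ i, fun ω : ∀ i, Ω i => X i (ω i)) 2 (Measure.pi μ) :=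
    memLp_finsetSum' _ fun i _ => hX' i
  have hm : ∫ ω, (∑ i, fun ω : ∀ i, Ω i => X i (ω i)) ω ∂(Measure.pi μ) =
      ∑ i, ∫ x, X i x ∂(μ i) := by
    simp only [Finset.sum_apply]
    rw [integral_finsetSum _ fun i _ => (hX' i).integrable (by norm_num)]
    refine Finset.sum_congr rfl fun i _ => ?_
    exact integral_comp_eval (hX i).1
  have h := meas_ge_le_variance_div_sq hs ht
  rw [hm, variance_sum_pi hX] at h
  simp only [Finset.sum_apply] at h
  refine (ENNReal.toReal_mono ENNReal.ofReal_ne_top h).trans ?_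
  rw [ENNReal.toReal_ofReal (div_nonneg (Finset.sum_nonneg fun i _ => variance_nonneg _ _)
    (sq_nonneg t))]
  gcongr

/-- The density is at least 3/10 on (-1/2, 1/2), an interval of length 1, and the two tails share
the remaining mass equally. Any bound below 1/2 would make pseudo-labels informative. -/
lemma gaussianReal_Iic_neg_half_le :
    (gaussianReal 0 1).real (Set.Iic (-(1 / 2))) ≤ 7 / 20 := by
  set γ := gaussianReal 0 1
  have hsymm : γ.real (Set.Iic (-(1 / 2))) = γ.real (Set.Ici (1 / 2)) := by
    have h : γ.map (fun x => -x) = γ := by simpa using gaussianReal_map_neg (μ := 0) (v := 1)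
    conv_lhs => rw [← h]
    rw [map_measureReal_apply (by fun_prop) measurableSet_Iic]
    congr 1
    ext x
    simp
  have hmid : 3 / 10 ≤ γ.real (Set.Ioo (-(1 / 2)) (1 / 2)) := by
    have hpdf : ∀ x ∈ Set.Ioo (-(1 / 2) : ℝ) (1 / 2), 3 / 10 ≤ gaussianPDFReal 0 1 x := by
      intro x hx
      have hx2 : x ^ 2 ≤ 1 / 4 := by nlinarith [hx.1, hx.2]
      have hexp : 7 / 8 ≤ Real.exp (-x ^ 2 / 2) := by
        have := Real.add_one_le_exp (-x ^ 2 / 2)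
        linarith
      have hs : √(2 * Real.pi) ≤ 29 / 10 := by
        rw [Real.sqrt_le_left (by norm_num)]
        nlinarith [Real.pi_lt_d2]
      have hs0 : 0 < √(2 * Real.pi) := by positivity
      have : gaussianPDFReal 0 1 x = (√(2 * Real.pi))⁻¹ * Real.exp (-x ^ 2 / 2) := by
        simp [gaussianPDFReal]
      rw [this, inv_mul_eq_div, le_div_iff₀ hs0]
      linarith
    have hint := setIntegral_mono_on (μ := volume) (s := Set.Ioo (-(1 / 2) : ℝ) (1 / 2))
      (by simp) (integrable_gaussianPDFReal 0 1).integrableOn measurableSet_Ioo hpdf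
    rw [setIntegral_const] at hint
    have hγ : γ.real (Set.Ioo (-(1 / 2)) (1 / 2)) =
        ∫ x in Set.Ioo (-(1 / 2) : ℝ) (1 / 2), gaussianPDFReal 0 1 x := by
      rw [measureReal_def, gaussianReal_apply_eq_integral 0 one_ne_zero, ENNReal.toReal_ofReal]
      exact integral_nonneg fun x => gaussianPDFReal_nonneg 0 1 x
    rw [hγ]
    refine le_trans ?_ hint
    norm_num [measureReal_def]
  have hunion : γ.real (Set.Iic (-(1 / 2))) + γ.real (Set.Ioo (-(1 / 2)) (1 / 2))
      + γ.real (Set.Ici (1 / 2)) ≤ 1 := by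
    rw [← measureReal_union _ measurableSet_Ioo, ← measureReal_union _ measurableSet_Ici]
    · exact measureReal_le_one
    · rw [Set.disjoint_left]
      rintro x (hx | hx) hx'
      · simp only [Set.mem_Iic, Set.mem_Ici] at hx hx'; linarith
      · simp only [Set.mem_Ici] at hx'; linarith [hx.2]
    · rw [Set.disjoint_left]
      intro x hx hx'
      simp only [Set.mem_Iic] at hx; linarith [hx'.1]
  linarith

/-! ### Isotropic Gaussian laws -/

instance (v : EuclideanSpace ℝ (Fin d)) (σ : ℝ) : IsGaussian (isoGaussian v σ) := by
  unfold isoGaussian; infer_instance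

lemma charFun_isoGaussian (v : EuclideanSpace ℝ (Fin d)) (σ : ℝ) (t : EuclideanSpace ℝ (Fin d)) :
    charFun (isoGaussian v σ) t =
      Complex.exp (inner ℝ t v * Complex.I - (σ ^ 2 * ‖t‖ ^ 2 : ℝ) / 2) := by
  rw [isoGaussian, charFun_multivariateGaussian (Matrix.PosSemidef.one.smul (sq_nonneg σ))]
  congr 3
  rw [Matrix.smul_mulVec, Matrix.one_mulVec, dotProduct_smul, EuclideanSpace.real_norm_sq_eq]
  simp [dotProduct, pow_two]

lemma isoGaussian_ext {ν : Measure (EuclideanSpace ℝ (Fin d))} [IsFiniteMeasure ν]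
    {v : EuclideanSpace ℝ (Fin d)} {σ : ℝ}
    (h : ∀ t, charFun ν t =
      Complex.exp (inner ℝ t v * Complex.I - (σ ^ 2 * ‖t‖ ^ 2 : ℝ) / 2)) :
    ν = isoGaussian v σ := by
  refine Measure.ext_of_charFun ?_
  funext t
  rw [h, charFun_isoGaussian]

lemma isoGaussian_map_add_smul (v : EuclideanSpace ℝ (Fin d)) (σ c : ℝ)
    (w : EuclideanSpace ℝ (Fin d)) :
    (isoGaussian v σ).map (fun x => w + c • x) = isoGaussian (w + c • v) (c * σ) := by
  have hmap : (isoGaussian v σ).map (fun x => w + c • x) =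
      ((isoGaussian v σ).map (fun x => c • x)).map (fun x => w + x) := by
    rw [Measure.map_map (by fun_prop) (by fun_prop)]; rfl
  have : IsProbabilityMeasure ((isoGaussian v σ).map (fun x => c • x)) :=
    Measure.isProbabilityMeasure_map (by fun_prop)
  have : IsProbabilityMeasure ((isoGaussian v σ).map (fun x => w + c • x)) :=
    Measure.isProbabilityMeasure_map (by fun_prop)
  refine isoGaussian_ext fun t => ?_
  rw [hmap, charFun_map_const_add, charFun_map_smul, charFun_isoGaussian, ← Complex.exp_add]
  congr 1
  simp only [inner_smul_left, inner_add_right, inner_smul_right, norm_smul, mul_pow,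
    Real.norm_eq_abs, sq_abs, real_inner_comm w t]
  push_cast
  simp
  ring

/-- Only the squares of the weights enter the variance. With zero means and weights ±1/m the law is
the same for every choice of signs, which makes the averaged orthogonal noise independent of the
pseudo-labels. -/
lemma isoGaussian_map_sum_smul {ι : Type*} [Fintype ι] (v : ι → EuclideanSpace ℝ (Fin d))
    (c : ι → ℝ) {σ τ : ℝ} (hτ : τ ^ 2 = σ ^ 2 * ∑ i, c i ^ 2) :
    (Measure.pi fun i => isoGaussian (v i) σ).map (fun x => ∑ i, c i • x i) =
      isoGaussian (∑ i, c i • v i) τ := by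
  have : ∀ i, IsProbabilityMeasure ((isoGaussian (v i) σ).map (fun x => c i • x)) :=
    fun i => Measure.isProbabilityMeasure_map (by fun_prop)
  have hmap : (Measure.pi fun i => isoGaussian (v i) σ).map (fun x => ∑ i, c i • x i) =
      (Measure.pi fun i => (isoGaussian (v i) σ).map (fun x => c i • x)).map
        (fun x => ∑ i, x i) := by
    rw [← Measure.pi_map_pi (f := fun i x => c i • x) (fun i => by fun_prop),
      Measure.map_map (by fun_prop) (by fun_prop)]
    rfl
  have : IsProbabilityMeasure
      ((Measure.pi fun i => isoGaussian (v i) σ).map (fun x => ∑ i, c i • x i)) :=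
    Measure.isProbabilityMeasure_map (Measurable.aemeasurable (by fun_prop))
  refine isoGaussian_ext fun t => ?_
  rw [hmap, charFun_map_sum_pi_eq_prod, Finset.prod_apply]
  simp_rw [charFun_map_smul, charFun_isoGaussian]
  rw [← Complex.exp_sum, hτ]
  congr 1
  rw [Finset.sum_sub_distrib, ← Finset.sum_mul, ← Finset.sum_div, inner_sum]
  simp only [inner_smul_left, inner_smul_right, norm_smul, mul_pow,
    Real.norm_eq_abs, sq_abs, Finset.mul_sum, Finset.sum_mul]
  push_cast
  simp only [Finset.sum_mul, conj_trivial]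
  congr 2
  exact Finset.sum_congr rfl fun i _ => by ring

/-- The component of `w` orthogonal to the unit vector `u`. -/
def perp (u w : EuclideanSpace ℝ (Fin d)) : EuclideanSpace ℝ (Fin d) := w - inner ℝ u w • u

@[fun_prop]
lemma continuous_perp (u : EuclideanSpace ℝ (Fin d)) : Continuous (perp u) := by
  unfold perp; fun_prop

@[fun_prop]
lemma measurable_perp (u : EuclideanSpace ℝ (Fin d)) : Measurable (perp u) :=
  (continuous_perp u).measurable

lemma inner_perp_left (u w t : EuclideanSpace ℝ (Fin d)) :
    inner ℝ (perp u w) t = inner ℝ w (perp u t) := by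
  simp only [perp, inner_sub_left, inner_sub_right, inner_smul_left, inner_smul_right]
  rw [real_inner_comm u w]
  simp
  ring

/-- Pythagoras. For u = 0 the map `perp u` is the identity; admitting this case lets a vanishing
first-stage estimator be treated like any other. -/
lemma norm_perp_sq {u : EuclideanSpace ℝ (Fin d)} (hu : u = 0 ∨ ‖u‖ = 1)
    (w : EuclideanSpace ℝ (Fin d)) : ‖perp u w‖ ^ 2 = ‖w‖ ^ 2 - inner ℝ u w ^ 2 := by
  rcases hu with rfl | hu
  · simp [perp]
  · rw [perp, norm_sub_sq_real, inner_smul_right, norm_smul, hu, real_inner_comm]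
    simp
    ring

lemma norm_perp_le {u : EuclideanSpace ℝ (Fin d)} (hu : u = 0 ∨ ‖u‖ = 1)
    (w : EuclideanSpace ℝ (Fin d)) : ‖perp u w‖ ≤ ‖w‖ := by
  refine abs_le_of_sq_le_sq' ?_ (norm_nonneg _) |>.2
  rw [norm_perp_sq hu]
  linarith [sq_nonneg (inner ℝ u w)]

lemma perp_sum {ι : Type*} (s : Finset ι) (u : EuclideanSpace ℝ (Fin d))
    (w : ι → EuclideanSpace ℝ (Fin d)) : perp u (∑ i ∈ s, w i) = ∑ i ∈ s, perp u (w i) := by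
  simp [perp, inner_sum, Finset.sum_smul]

lemma perp_smul (u : EuclideanSpace ℝ (Fin d)) (c : ℝ) (w : EuclideanSpace ℝ (Fin d)) :
    perp u (c • w) = c • perp u w := by
  simp [perp, inner_smul_right, smul_sub, smul_smul]

/-- An isotropic Gaussian vector splits into independent components along a unit vector `u` and
orthogonal to it. -/
lemma isoGaussian_eq_map_prod {u : EuclideanSpace ℝ (Fin d)} (hu : u = 0 ∨ ‖u‖ = 1)
    (v : EuclideanSpace ℝ (Fin d)) (σ : ℝ) :
    ((gaussianReal 0 (σ ^ 2).toNNReal).prod (isoGaussian 0 σ)).map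
      (fun p => v + p.1 • u + perp u p.2) = isoGaussian v σ := by
  have : IsProbabilityMeasure (((gaussianReal 0 (σ ^ 2).toNNReal).prod (isoGaussian 0 σ)).map
      (fun p => v + p.1 • u + perp u p.2)) :=
    Measure.isProbabilityMeasure_map (by fun_prop)
  refine isoGaussian_ext fun t => ?_
  rw [charFun_apply, integral_map (by fun_prop) (by fun_prop)]
  have h : ∀ p : ℝ × EuclideanSpace ℝ (Fin d),
      Complex.exp (inner ℝ (v + p.1 • u + perp u p.2) t * Complex.I) =
      Complex.exp (inner ℝ t v * Complex.I) * (Complex.exp (inner ℝ p.1 (inner ℝ u t) * Complex.I) *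
        Complex.exp (inner ℝ p.2 (perp u t) * Complex.I)) := by
    intro p
    rw [← Complex.exp_add, ← Complex.exp_add, inner_add_left, inner_add_left, inner_perp_left,
      real_inner_comm t v, inner_smul_left]
    congr 1
    push_cast
    simp
    ring
  simp_rw [h]
  -- The two characteristic functions contribute ⟨u, t⟩² and ‖perp u t‖² to the exponent, which add
  -- up to ‖t‖².
  rw [integral_const_mul, integral_prod_mul (μ := gaussianReal 0 (σ ^ 2).toNNReal)
    (fun z : ℝ => Complex.exp (inner ℝ z (inner ℝ u t) * Complex.I))
    (fun w : EuclideanSpace ℝ (Fin d) => Complex.exp (inner ℝ w (perp u t) * Complex.I)),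
    ← charFun_apply, ← charFun_apply, charFun_isoGaussian, charFun_gaussianReal,
    ← Complex.exp_add, ← Complex.exp_add, norm_perp_sq hu]
  congr 1
  have : ((σ ^ 2).toNNReal : ℝ) = σ ^ 2 := Real.coe_toNNReal _ (sq_nonneg σ)
  rw [this]
  push_cast
  simp
  ring

lemma isoGaussian_map_inner (v θ : EuclideanSpace ℝ (Fin d)) (σ : ℝ) :
    (isoGaussian v σ).map (fun x => inner ℝ θ x) =
      gaussianReal (inner ℝ θ v) (σ ^ 2 * ‖θ‖ ^ 2).toNNReal := by
  have : IsProbabilityMeasure ((isoGaussian v σ).map (fun x => inner ℝ θ x)) :=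
    Measure.isProbabilityMeasure_map (by fun_prop)
  refine Measure.ext_of_charFun ?_
  funext t
  rw [charFun_gaussianReal, charFun_apply, integral_map (by fun_prop) (by fun_prop)]
  have h : ∀ x : EuclideanSpace ℝ (Fin d), Complex.exp (inner ℝ (inner ℝ θ x) t * Complex.I) =
      Complex.exp (inner ℝ x (t • θ) * Complex.I) := by
    intro x
    rw [inner_smul_right, real_inner_comm x θ]
    simp
  simp_rw [h]
  rw [← charFun_apply, charFun_isoGaussian, inner_smul_left, norm_smul,
    Real.coe_toNNReal _ (by positivity), mul_pow, Real.norm_eq_abs, sq_abs]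
  congr 1
  push_cast
  simp
  ring

/-- Chebyshev's inequality for a linear functional of an isotropic Gaussian vector. -/
lemma isoGaussian_inner_deviation (v θ : EuclideanSpace ℝ (Fin d)) {σ T N : ℝ} (hT : 0 < T)
    (hσ : 0 < σ) (hN : 0 < N) (hθ : ‖θ‖ ≤ N) :
    (isoGaussian v σ).real {x | T * (σ * N) ≤ |inner ℝ θ x - inner ℝ θ v|} ≤ 1 / T ^ 2 := by
  have h1 := meas_ge_le_variance_div_sq
    (memLp_id_gaussianReal (μ := inner ℝ θ v) (v := (σ ^ 2 * ‖θ‖ ^ 2).toNNReal) 2)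
    (mul_pos hT (mul_pos hσ hN))
  rw [variance_id_gaussianReal] at h1
  have hS : {x : EuclideanSpace ℝ (Fin d) | T * (σ * N) ≤ |inner ℝ θ x - inner ℝ θ v|} =
      (fun x => inner ℝ θ x) ⁻¹' {y : ℝ | T * (σ * N) ≤ |y - inner ℝ θ v|} := rfl
  rw [hS, ← map_measureReal_apply (by fun_prop) (measurableSet_le (by fun_prop) (by fun_prop)),
    isoGaussian_map_inner]
  simp only [id, integral_id_gaussianReal] at h1
  refine (ENNReal.toReal_mono ENNReal.ofReal_ne_top h1).trans ?_
  rw [Real.coe_toNNReal _ (by positivity), ENNReal.toReal_ofReal (by positivity),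
    div_le_div_iff₀ (by positivity) (by positivity)]
  calc σ ^ 2 * ‖θ‖ ^ 2 * T ^ 2 ≤ σ ^ 2 * N ^ 2 * T ^ 2 := by gcongr
    _ = 1 * (T * (σ * N)) ^ 2 := by ring

lemma isoGaussian_zero_eq_map_pi (τ : ℝ) :
    isoGaussian (0 : EuclideanSpace ℝ (Fin d)) τ =
      (Measure.pi fun _ : Fin d => gaussianReal 0 1).map (fun x => τ • WithLp.toLp 2 x) := by
  have h1 : isoGaussian (0 : EuclideanSpace ℝ (Fin d)) 1 = stdGaussian _ := by
    simp [isoGaussian]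
  have h2 := isoGaussian_map_add_smul (0 : EuclideanSpace ℝ (Fin d)) 1 τ 0
  rw [h1, ← map_pi_eq_stdGaussian, Measure.map_map (by fun_prop) (by fun_prop)] at h2
  simp only [smul_zero, add_zero, mul_one, zero_add] at h2
  exact h2.symm

/-- After scaling by τ², ‖g‖² has mean d and variance 2d; Chebyshev at distance d gives 2d/d². -/
lemma isoGaussian_norm_sq_deviation (hd : 0 < d) (τ : ℝ) :
    (isoGaussian (0 : EuclideanSpace ℝ (Fin d)) τ).real {g | 2 * d * τ ^ 2 < ‖g‖ ^ 2} ≤ 2 / d := by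
  have hd' : (0 : ℝ) < d := by exact_mod_cast hd
  rw [isoGaussian_zero_eq_map_pi, map_measureReal_apply (by fun_prop)
    (measurableSet_lt (by fun_prop) (by fun_prop))]
  have h := chebyshev_sum_pi (ι := Fin d) (μ := fun _ => gaussianReal 0 1)
    (X := fun _ x => x ^ 2) (fun _ => by simpa using memLp_pow_gaussianReal 2 2 1) hd'
    (V := 2 * d) (by simp [variance_sq_gaussianReal, mul_comm])
  refine (measureReal_mono ?_).trans (h.trans (le_of_eq (by field_simp)))
  intro x hx
  simp only [Set.mem_preimage, Set.mem_ofPred_eq, EuclideanSpace.real_norm_sq_eq,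
    PiLp.smul_apply, smul_eq_mul, mul_pow, ← Finset.mul_sum, integral_sq_gaussianReal] at hx ⊢
  have hx2 : 2 * (d : ℝ) < ∑ i, x i ^ 2 := by
    rw [mul_comm] at hx
    exact lt_of_mul_lt_mul_left hx (sq_nonneg τ)
  refine le_trans ?_ (le_abs_self _)
  simp
  linarith

/-- The scaled mean per coordinate is at least 5/9, which leaves a gap of 5/9 - 1/2 = 1/18 and hence
the constant 18² = 324. -/
lemma isoGaussian_l1_deviation (hd : 0 < d) {τ : ℝ} (hτ : 0 < τ) :
    (isoGaussian (0 : EuclideanSpace ℝ (Fin d)) τ).real {g | ∑ j, |g j| < d * τ / 2} ≤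
      324 / d := by
  have hd' : (0 : ℝ) < d := by exact_mod_cast hd
  rw [isoGaussian_zero_eq_map_pi, map_measureReal_apply (by fun_prop)
    (measurableSet_lt (by fun_prop) (by fun_prop))]
  have h := chebyshev_sum_pi (ι := Fin d) (μ := fun _ => gaussianReal 0 1)
    (X := fun _ x => |x|) (fun _ => memLp_abs_gaussianReal 1) (t := d / 18) (by positivity)
    (V := d) ((Finset.sum_le_sum fun i _ => variance_abs_gaussianReal_le).trans (by simp))
  refine (measureReal_mono ?_).trans (h.trans (le_of_eq (by field_simp; norm_num)))
  intro x hx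
  simp only [Set.mem_preimage, Set.mem_ofPred_eq, PiLp.smul_apply, smul_eq_mul, abs_mul,
    ← Finset.mul_sum, abs_of_pos hτ] at hx ⊢
  have hx2 : ∑ i, |x i| < d / 2 := by
    rw [show (d : ℝ) * τ / 2 = τ * (d / 2) by ring] at hx
    exact lt_of_mul_lt_mul_left hx hτ.le
  have hm : d * (5 / 9 : ℝ) ≤ ∑ _ : Fin d, ∫ x, |x| ∂(gaussianReal 0 1) := by
    simp only [Finset.sum_const, Finset.card_univ, Fintype.card_fin, nsmul_eq_mul]
    exact mul_le_mul_of_nonneg_left le_integral_abs_gaussianReal hd'.le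
  refine le_trans ?_ (neg_le_abs _)
  linarith

/-! ### The laws of the estimators -/

instance (μ : EuclideanSpace ℝ (Fin d)) (σ : ℝ) : IsProbabilityMeasure (dataLaw μ σ) := by
  constructor
  simp [dataLaw, ENNReal.inv_two_add_inv_two]

instance {n : ℕ} (μ : EuclideanSpace ℝ (Fin d)) (σ : ℝ) :
    IsProbabilityMeasure (labeledLaw μ σ n) := by
  unfold labeledLaw; infer_instance

instance {m : ℕ} (μ : EuclideanSpace ℝ (Fin d)) (σ : ℝ) (S : Finset (Fin m)) (i : Fin m) :
    IsProbabilityMeasure (if i ∈ S then (dataLaw μ σ).fst else isoGaussian 0 σ) := by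
  split_ifs <;> infer_instance

instance {m : ℕ} (μ : EuclideanSpace ℝ (Fin d)) (σ : ℝ) (S : Finset (Fin m)) :
    IsProbabilityMeasure (unlabeledLaw μ σ S) := by
  unfold unlabeledLaw; infer_instance

lemma measurable_linearClassifier :
    Measurable fun p : EuclideanSpace ℝ (Fin d) × EuclideanSpace ℝ (Fin d) =>
      linearClassifier p.1 p.2 := by
  unfold linearClassifier
  exact Measurable.ite (measurableSet_le (by fun_prop) (by fun_prop)) (by fun_prop) (by fun_prop)

lemma abs_linearClassifier (θ x : EuclideanSpace ℝ (Fin d)) : |linearClassifier θ x| = 1 := by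
  unfold linearClassifier
  split_ifs <;> simp

lemma linearClassifier_sq (θ x : EuclideanSpace ℝ (Fin d)) : linearClassifier θ x ^ 2 = 1 := by
  rw [← sq_abs, abs_linearClassifier, one_pow]

lemma measurable_supervisedEstimator {n : ℕ} :
    Measurable (supervisedEstimator : (Fin n → EuclideanSpace ℝ (Fin d) × ℝ) → _) := by
  unfold supervisedEstimator
  fun_prop

lemma measurable_supervisedEstimator_pseudoLabeled {m : ℕ} (θ : EuclideanSpace ℝ (Fin d)) :
    Measurable fun x : Fin m → EuclideanSpace ℝ (Fin d) =>
      supervisedEstimator fun i => (x i, linearClassifier θ (x i)) :=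
  measurable_supervisedEstimator.comp (measurable_pi_lambda _ fun i => Measurable.prodMk
    (by fun_prop) (measurable_linearClassifier.comp (Measurable.prodMk (by fun_prop)
      (by fun_prop))))

lemma measurable_selfTrainingEstimator {n m : ℕ} :
    Measurable fun z : (Fin n → EuclideanSpace ℝ (Fin d) × ℝ) × (Fin m → EuclideanSpace ℝ (Fin d)) =>
      selfTrainingEstimator z.1 z.2 := by
  unfold selfTrainingEstimator
  refine measurable_supervisedEstimator.comp (measurable_pi_lambda _ fun i => ?_)
  refine Measurable.prodMk (by fun_prop) (measurable_linearClassifier.comp (Measurable.prodMk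
    (measurable_supervisedEstimator.comp measurable_fst) (by fun_prop)))

/-- Multiplying by the label turns both mixture components into the same Gaussian, since centered
noise is symmetric. -/
lemma dataLaw_map_smul (μ : EuclideanSpace ℝ (Fin d)) (σ : ℝ) :
    (dataLaw μ σ).map (fun p => p.2 • p.1) = isoGaussian μ σ := by
  have h := isoGaussian_map_add_smul (-μ) σ (-1) 0
  have hneg : isoGaussian μ (-σ) = isoGaussian μ σ := by simp [isoGaussian]
  simp only [zero_add, neg_smul, one_smul, neg_neg, neg_mul, one_mul, hneg] at h
  rw [dataLaw, Measure.map_add _ _ (by fun_prop), Measure.map_smul, Measure.map_smul,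
    Measure.prod_dirac, Measure.prod_dirac, Measure.map_map (by fun_prop) (by fun_prop),
    Measure.map_map (by fun_prop) (by fun_prop)]
  simp only [Function.comp_def, one_smul, neg_smul, Measure.map_id', h]
  rw [← add_smul, ENNReal.inv_two_add_inv_two, one_smul]

lemma labeledLaw_map_supervisedEstimator {n : ℕ} (hn : 0 < n) (μ : EuclideanSpace ℝ (Fin d))
    (σ : ℝ) : (labeledLaw μ σ n).map supervisedEstimator = isoGaussian μ (σ / √n) := by
  have hn' : (0 : ℝ) < n := by exact_mod_cast hn
  have h := isoGaussian_map_sum_smul (fun _ : Fin n => μ) (fun _ => (n : ℝ)⁻¹) (σ := σ)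
    (τ := σ / √n) (by rw [div_pow, Real.sq_sqrt hn'.le]; simp; field_simp)
  have hμ : ∑ _ : Fin n, (n : ℝ)⁻¹ • μ = μ := by
    simp [← Nat.cast_smul_eq_nsmul ℝ, smul_smul, hn'.ne']
  rw [hμ] at h
  rw [← h, ← dataLaw_map_smul, ← Measure.pi_map_pi (by fun_prop),
    Measure.map_map (by fun_prop) (by fun_prop), labeledLaw]
  congr 1
  funext s
  simp [supervisedEstimator, Finset.smul_sum]

/-- The direction of `θ`, or `0` if `θ = 0`. -/
def dir (θ : EuclideanSpace ℝ (Fin d)) : EuclideanSpace ℝ (Fin d) := ‖θ‖⁻¹ • θ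

lemma dir_eq_zero_or_norm (θ : EuclideanSpace ℝ (Fin d)) : dir θ = 0 ∨ ‖dir θ‖ = 1 := by
  by_cases h : θ = 0
  · left; simp [dir, h]
  · right; exact norm_smul_inv_norm h

lemma norm_dir_le_one (θ : EuclideanSpace ℝ (Fin d)) : ‖dir θ‖ ≤ 1 := by
  rcases dir_eq_zero_or_norm θ with h | h <;> simp [h]

lemma norm_smul_dir (θ : EuclideanSpace ℝ (Fin d)) : ‖θ‖ • dir θ = θ := by
  by_cases h : θ = 0
  · simp [h]
  · simp [dir, smul_smul, norm_ne_zero_iff.2 h]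

lemma inner_perp_dir (θ w : EuclideanSpace ℝ (Fin d)) : inner ℝ θ (perp (dir θ) w) = 0 := by
  rw [← inner_perp_left]
  have : perp (dir θ) θ = 0 := by
    by_cases h : θ = 0
    · simp [perp, h]
    · have h' := norm_ne_zero_iff.2 h
      simp only [perp, dir, inner_smul_left, real_inner_self_eq_norm_sq, smul_smul, conj_trivial]
      field_simp
      simp
  rw [this, inner_zero_left]

/-- The law of the true label of an unlabeled input, with `0` for the irrelevant ones. -/
def labelLaw {m : ℕ} (S : Finset (Fin m)) (i : Fin m) : Measure ℝ :=
  if i ∈ S then (2⁻¹ : ℝ≥0∞) • Measure.dirac 1 + (2⁻¹ : ℝ≥0∞) • Measure.dirac (-1)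
    else Measure.dirac 0

instance {m : ℕ} (S : Finset (Fin m)) (i : Fin m) : IsProbabilityMeasure (labelLaw S i) := by
  unfold labelLaw
  split_ifs
  · constructor; simp [ENNReal.inv_two_add_inv_two]
  · infer_instance

/-- The law of the pair of the true label (`0` for an irrelevant input) and the noise component in
a fixed direction. -/
def coreLaw {m : ℕ} (σ : ℝ) (S : Finset (Fin m)) (i : Fin m) : Measure (ℝ × ℝ) :=
  (labelLaw S i).prod (gaussianReal 0 (σ ^ 2).toNNReal)

instance {m : ℕ} (σ : ℝ) (S : Finset (Fin m)) (i : Fin m) :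
    IsProbabilityMeasure (coreLaw σ S i) := by
  unfold coreLaw; infer_instance

/-- The convention that irrelevant inputs carry label 0 lets one formula generate both kinds of
input: conditionally on the label y the result is N(yμ, σ²I). -/
lemma coreLaw_prod_map {m : ℕ} (μ : EuclideanSpace ℝ (Fin d)) (σ : ℝ) (S : Finset (Fin m))
    (i : Fin m) {u : EuclideanSpace ℝ (Fin d)} (hu : u = 0 ∨ ‖u‖ = 1) :
    ((coreLaw σ S i).prod (isoGaussian 0 σ)).map
      (fun p => p.1.1 • μ + p.1.2 • u + perp u p.2) =
      if i ∈ S then (dataLaw μ σ).fst else isoGaussian 0 σ := by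
  have key : ∀ y : ℝ, (((Measure.dirac y).prod (gaussianReal 0 (σ ^ 2).toNNReal)).prod
      (isoGaussian 0 σ)).map (fun p => p.1.1 • μ + p.1.2 • u + perp u p.2) =
      isoGaussian (y • μ) σ := by
    intro y
    have h : ((gaussianReal 0 (σ ^ 2).toNNReal).map (Prod.mk y)).prod (isoGaussian 0 σ) =
        ((gaussianReal 0 (σ ^ 2).toNNReal).prod
          (isoGaussian (0 : EuclideanSpace ℝ (Fin d)) σ)).map (Prod.map (Prod.mk y) id) := by
      rw [← Measure.map_prod_map _ _ (by fun_prop) measurable_id, Measure.map_id]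
    rw [← isoGaussian_eq_map_prod hu (y • μ) σ, Measure.dirac_prod, h,
      Measure.map_map (by fun_prop) (by fun_prop)]
    rfl
  unfold coreLaw labelLaw
  split_ifs with h
  · rw [Measure.add_prod, Measure.prod_smul_left, Measure.prod_smul_left, Measure.add_prod,
      Measure.prod_smul_left, Measure.prod_smul_left, Measure.map_add _ _ (by fun_prop),
      Measure.map_smul, Measure.map_smul, key, key, dataLaw, Measure.fst_add]
    simp [Measure.fst]
  · rw [key, zero_smul]

/-- The pseudo-label of an input with true label `q.1` and noise `q.2` in the direction of `θ`. -/
def pseudoLabel (μ θ : EuclideanSpace ℝ (Fin d)) (q : ℝ × ℝ) : ℝ :=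
  linearClassifier θ (q.1 • μ + q.2 • dir θ)

/-- The average product of pseudo-labels and true labels. -/
def signalCoeff {m : ℕ} (μ θ : EuclideanSpace ℝ (Fin d)) (q : Fin m → ℝ × ℝ) : ℝ :=
  (m : ℝ)⁻¹ * ∑ i, pseudoLabel μ θ (q i) * (q i).1

/-- The average pseudo-labeled noise in the direction of `θ`. -/
def dirCoeff {m : ℕ} (μ θ : EuclideanSpace ℝ (Fin d)) (q : Fin m → ℝ × ℝ) : ℝ :=
  (m : ℝ)⁻¹ * ∑ i, pseudoLabel μ θ (q i) * (q i).2

@[fun_prop]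
lemma measurable_pseudoLabel (μ θ : EuclideanSpace ℝ (Fin d)) :
    Measurable (fun q => pseudoLabel μ θ q) := by
  unfold pseudoLabel linearClassifier
  exact Measurable.ite (measurableSet_le (by fun_prop) (by fun_prop)) (by fun_prop) (by fun_prop)

@[fun_prop]
lemma measurable_signalCoeff {m : ℕ} (μ θ : EuclideanSpace ℝ (Fin d)) :
    Measurable (signalCoeff μ θ : (Fin m → ℝ × ℝ) → ℝ) := by
  unfold signalCoeff; fun_prop

@[fun_prop]
lemma measurable_dirCoeff {m : ℕ} (μ θ : EuclideanSpace ℝ (Fin d)) :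
    Measurable (dirCoeff μ θ : (Fin m → ℝ × ℝ) → ℝ) := by
  unfold dirCoeff; fun_prop

lemma pseudoLabel_sq (μ θ : EuclideanSpace ℝ (Fin d)) (q : ℝ × ℝ) : pseudoLabel μ θ q ^ 2 = 1 :=
  linearClassifier_sq _ _

/-- Given the first-stage estimator `θ`, the self-training estimator is a combination of the mean
`μ`, the direction of `θ` and an independent Gaussian vector orthogonal to `θ`. -/
lemma unlabeledLaw_map {m : ℕ} (hm : 0 < m) (μ θ : EuclideanSpace ℝ (Fin d)) (σ : ℝ)
    (S : Finset (Fin m)) :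
    (unlabeledLaw μ σ S).map (fun x => supervisedEstimator fun i => (x i, linearClassifier θ (x i))) =
      ((Measure.pi (coreLaw σ S)).prod (isoGaussian 0 (σ / √m))).map
        (fun p => signalCoeff μ θ p.1 • μ + dirCoeff μ θ p.1 • dir θ + perp (dir θ) p.2) := by
  have hm' : (0 : ℝ) < m := by exact_mod_cast hm
  have hu := dir_eq_zero_or_norm θ
  have hest := measurable_supervisedEstimator_pseudoLabeled (m := m) θ
  have h1 : unlabeledLaw μ σ S = (Measure.pi fun i => (coreLaw σ S i).prod (isoGaussian 0 σ)).map
      (fun f i => (f i).1.1 • μ + (f i).1.2 • dir θ + perp (dir θ) (f i).2) := by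
    have hp : ∀ i, IsProbabilityMeasure (((coreLaw σ S i).prod (isoGaussian 0 σ)).map
        (fun p => p.1.1 • μ + p.1.2 • dir θ + perp (dir θ) p.2)) :=
      fun i => Measure.isProbabilityMeasure_map (by fun_prop)
    rw [unlabeledLaw, Measure.pi_map_pi
      (f := fun _ (p : (ℝ × ℝ) × EuclideanSpace ℝ (Fin d)) =>
        p.1.1 • μ + p.1.2 • dir θ + perp (dir θ) p.2) (by fun_prop)]
    simp_rw [coreLaw_prod_map μ σ S _ hu]
  have h2 := ((measurePreserving_arrowProdEquivProdArrow (ℝ × ℝ) (EuclideanSpace ℝ (Fin d)) (Fin m)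
    (coreLaw σ S) (fun _ => isoGaussian 0 σ)).symm _).map_eq
  have hmeas : Measurable fun p : (Fin m → ℝ × ℝ) × (Fin m → EuclideanSpace ℝ (Fin d)) =>
      ∑ i, ((m : ℝ)⁻¹ * pseudoLabel μ θ (p.1 i)) • p.2 i := by
    fun_prop
  -- Given the labels and the noise along θ, the weights ±1/m have squares summing to 1/m, so the
  -- conditional law of the weighted sum is N(0, σ²/m I) whatever the signs: this is the
  -- independence of g from the coefficients.
  have h3 := (MeasurePreserving.skew_product (MeasurePreserving.id (Measure.pi (coreLaw σ S)))
    (g := fun q w => ∑ i, ((m : ℝ)⁻¹ * pseudoLabel μ θ (q i)) • w i)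
    (μc := Measure.pi fun _ : Fin m => isoGaussian (0 : EuclideanSpace ℝ (Fin d)) σ)
    (μd := isoGaussian 0 (σ / √m)) hmeas (ae_of_all _ fun q => by
      rw [isoGaussian_map_sum_smul _ _ (τ := σ / √m)]
      · simp
      · rw [div_pow, Real.sq_sqrt hm'.le]
        simp only [mul_pow, pseudoLabel_sq]
        simp
        field_simp)).map_eq
  rw [← h3, h1, ← h2, Measure.map_map (by fun_prop) (MeasurableEquiv.measurable _),
    Measure.map_map hest (by fun_prop), Measure.map_map (by fun_prop) (by fun_prop)]
  congr 1
  funext p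
  have hlab : ∀ i, linearClassifier θ ((p.1 i).1 • μ + (p.1 i).2 • dir θ + perp (dir θ) (p.2 i)) =
      pseudoLabel μ θ (p.1 i) := by
    intro i
    simp only [pseudoLabel, linearClassifier, inner_add_right, inner_perp_dir, add_zero]
  change supervisedEstimator (fun i =>
    ((p.1 i).1 • μ + (p.1 i).2 • dir θ + perp (dir θ) (p.2 i),
      linearClassifier θ ((p.1 i).1 • μ + (p.1 i).2 • dir θ + perp (dir θ) (p.2 i)))) =
    signalCoeff μ θ p.1 • μ + dirCoeff μ θ p.1 • dir θ +
      perp (dir θ) (∑ i, ((m : ℝ)⁻¹ * pseudoLabel μ θ (p.1 i)) • p.2 i)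
  simp only [hlab, supervisedEstimator, signalCoeff, dirCoeff, perp_sum, perp_smul, smul_add,
    Finset.sum_add_distrib, smul_smul, Finset.smul_sum, Finset.mul_sum, Finset.sum_smul]

/-! ### Concentration of the coefficients of the self-training estimator -/

lemma gaussianReal_eq_map_mul (σ : ℝ) :
    gaussianReal 0 (σ ^ 2).toNNReal = (gaussianReal 0 1).map (fun x => σ * x) := by
  rw [gaussianReal_map_const_mul]
  congr 1
  · simp
  · ext; simp [sq_nonneg]

lemma gaussianReal_Iic_le {σ : ℝ} (hσ : 0 < σ) :
    (gaussianReal 0 (σ ^ 2).toNNReal).real (Set.Iic (-(σ / 2))) ≤ 7 / 20 := by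
  rw [gaussianReal_eq_map_mul, map_measureReal_apply (by fun_prop) measurableSet_Iic]
  refine (measureReal_mono ?_).trans gaussianReal_Iic_neg_half_le
  intro x hx
  simp only [Set.mem_preimage, Set.mem_Iic] at hx ⊢
  nlinarith

lemma gaussianReal_Ici_le {σ : ℝ} (hσ : 0 < σ) :
    (gaussianReal 0 (σ ^ 2).toNNReal).real (Set.Ici (σ / 2)) ≤ 7 / 20 := by
  have h := gaussianReal_map_neg (μ := 0) (v := (σ ^ 2).toNNReal)
  rw [neg_zero] at h
  rw [← h, map_measureReal_apply (by fun_prop) measurableSet_Ici]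
  refine le_of_eq_of_le ?_ (gaussianReal_Iic_le hσ)
  congr 1
  ext x
  simp [le_neg]

lemma integrable_labelLaw {m : ℕ} (S : Finset (Fin m)) (i : Fin m) (f : ℝ → ℝ) :
    Integrable f (labelLaw S i) := by
  unfold labelLaw
  split_ifs
  · exact ((integrable_dirac (by simp)).smul_measure (by simp)).add_measure
      ((integrable_dirac (by simp)).smul_measure (by simp))
  · exact integrable_dirac (by simp)

lemma integral_labelLaw {m : ℕ} (S : Finset (Fin m)) (i : Fin m) (f : ℝ → ℝ) :
    ∫ y, f y ∂(labelLaw S i) = if i ∈ S then (f 1 + f (-1)) / 2 else f 0 := by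
  unfold labelLaw
  split_ifs
  · rw [integral_add_measure ((integrable_dirac (by simp)).smul_measure (by simp))
      ((integrable_dirac (by simp)).smul_measure (by simp))]
    simp
    ring
  · simp

lemma memLp_label {m : ℕ} (μ θ : EuclideanSpace ℝ (Fin d)) (σ : ℝ) (S : Finset (Fin m))
    (i : Fin m) : MemLp (fun q => pseudoLabel μ θ q * q.1) 2 (coreLaw σ S i) := by
  rw [memLp_two_iff_integrable_sq (Measurable.aestronglyMeasurable (by fun_prop))]
  simp only [mul_pow, pseudoLabel_sq, one_mul]
  rw [coreLaw]
  exact (integrable_labelLaw S i fun y => y ^ 2).comp_fst _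

lemma memLp_noise {m : ℕ} (μ θ : EuclideanSpace ℝ (Fin d)) (σ : ℝ) (S : Finset (Fin m))
    (i : Fin m) : MemLp (fun q => pseudoLabel μ θ q * q.2) 2 (coreLaw σ S i) := by
  rw [memLp_two_iff_integrable_sq (Measurable.aestronglyMeasurable (by fun_prop))]
  simp only [mul_pow, pseudoLabel_sq, one_mul]
  exact (integrable_pow_gaussianReal 2 _).comp_snd _

lemma variance_label_le {m : ℕ} (μ θ : EuclideanSpace ℝ (Fin d)) (σ : ℝ) (S : Finset (Fin m))
    (i : Fin m) :
    Var[fun q => pseudoLabel μ θ q * q.1; coreLaw σ S i] ≤ if i ∈ S then 1 else 0 := by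
  refine (variance_le_expectation_sq (Measurable.aestronglyMeasurable (by fun_prop))).trans ?_
  simp only [Pi.pow_apply, mul_pow, pseudoLabel_sq, one_mul]
  rw [coreLaw, integral_fun_fst (fun y : ℝ => y ^ 2), integral_labelLaw]
  simp

lemma integral_noise_sq {m : ℕ} (σ : ℝ) (S : Finset (Fin m)) (i : Fin m) :
    ∫ q, q.2 ^ 2 ∂(coreLaw σ S i) = σ ^ 2 := by
  rw [coreLaw, integral_fun_snd (fun y : ℝ => y ^ 2), integral_sq_gaussianReal]
  simp [sq_nonneg]

lemma variance_noise_le {m : ℕ} (μ θ : EuclideanSpace ℝ (Fin d)) (σ : ℝ) (S : Finset (Fin m))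
    (i : Fin m) : Var[fun q => pseudoLabel μ θ q * q.2; coreLaw σ S i] ≤ σ ^ 2 := by
  refine (variance_le_expectation_sq (Measurable.aestronglyMeasurable (by fun_prop))).trans ?_
  simp only [Pi.pow_apply, mul_pow, pseudoLabel_sq, one_mul]
  rw [integral_noise_sq]

lemma inner_dir_self (θ : EuclideanSpace ℝ (Fin d)) : inner ℝ θ (dir θ) = ‖θ‖ := by
  by_cases h : θ = 0
  · simp [h]
  · rw [dir, inner_smul_right, real_inner_self_eq_norm_sq, pow_two,
      inv_mul_cancel_left₀ (norm_ne_zero_iff.2 h)]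

lemma inner_eq_norm_mul_dir (θ v : EuclideanSpace ℝ (Fin d)) :
    inner ℝ θ v = ‖θ‖ * inner ℝ (dir θ) v := by
  conv_lhs => rw [← norm_smul_dir θ]
  rw [inner_smul_left]
  simp

lemma pseudoLabel_eq (μ θ : EuclideanSpace ℝ (Fin d)) (q : ℝ × ℝ) :
    pseudoLabel μ θ q =
      if 0 ≤ ‖θ‖ * (q.1 * inner ℝ (dir θ) μ + q.2) then 1 else -1 := by
  rw [pseudoLabel, linearClassifier, inner_add_right, inner_smul_right, inner_smul_right,
    inner_dir_self, inner_eq_norm_mul_dir θ μ]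
  congr 2
  ring

/-- The pseudo-label is nondecreasing in the noise z. Replacing it by its value at z = 0 can only
decrease the product with z, and the replaced product has mean zero. -/
lemma integral_noise_nonneg {m : ℕ} (μ θ : EuclideanSpace ℝ (Fin d)) (σ : ℝ)
    (S : Finset (Fin m)) (i : Fin m) :
    0 ≤ ∫ q, pseudoLabel μ θ q * q.2 ∂(coreLaw σ S i) := by
  have hint := (memLp_noise μ θ σ S i).integrable (by norm_num)
  rw [coreLaw] at hint ⊢
  rw [integral_prod _ hint]
  refine integral_nonneg fun y => ?_
  set γ := gaussianReal 0 (σ ^ 2).toNNReal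
  have hz : Integrable (fun z : ℝ => z) γ := by simpa using integrable_pow_gaussianReal 1 _
  have h0 : ∫ z, pseudoLabel μ θ (y, 0) * z ∂γ = 0 := by
    rw [integral_const_mul]
    simp [γ]
  rw [Pi.zero_apply, ← h0]
  refine integral_mono (hz.const_mul _) ?_ fun z => ?_
  · refine hz.bdd_mul (c := 1) (Measurable.aestronglyMeasurable (by fun_prop)) (ae_of_all _ fun z => ?_)
    rw [Real.norm_eq_abs, pseudoLabel, abs_linearClassifier]
  · simp only [pseudoLabel_eq]
    have hθ := norm_nonneg θ
    split_ifs with h1 h2 h2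
    · rfl
    · have : z ≤ 0 := by
        by_contra hz
        exact h2 (h1.trans (mul_le_mul_of_nonneg_left (by linarith) hθ))
      linarith
    · have : 0 ≤ z := by
        by_contra hz
        exact h1 (h2.trans (mul_le_mul_of_nonneg_left (by linarith) hθ))
      linarith
    · rfl

/-- A relevant input is mislabeled only if its noise along θ exceeds σ/2 in the wrong direction,
which has probability at most 7/20; and 1 - 2 · 7/20 = 3/10. -/
lemma le_integral_label {m : ℕ} {μ θ : EuclideanSpace ℝ (Fin d)} {σ : ℝ} (hσ : 0 < σ)
    (hθ : σ / 2 ≤ inner ℝ (dir θ) μ) (S : Finset (Fin m)) (i : Fin m) :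
    (if i ∈ S then 3 / 10 else 0) ≤ ∫ q, pseudoLabel μ θ q * q.1 ∂(coreLaw σ S i) := by
  have hint := (memLp_label μ θ σ S i).integrable (by norm_num)
  rw [coreLaw] at hint ⊢
  rw [integral_prod _ hint, integral_labelLaw]
  set γ := gaussianReal 0 (σ ^ 2).toNNReal
  have hpos : 0 < ‖θ‖ := by
    rw [norm_pos_iff]
    rintro rfl
    simp [dir] at hθ
    linarith
  have hI : ∀ y : ℝ, Integrable (fun z => pseudoLabel μ θ (y, z) * y) γ := by
    intro y
    refine Integrable.mul_const ?_ y
    refine Integrable.of_bound (Measurable.aestronglyMeasurable (by fun_prop)) 1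
      (ae_of_all _ fun z => ?_)
    rw [Real.norm_eq_abs, pseudoLabel, abs_linearClassifier]
  -- A contains all noise values that can flip the label y, so the integrand is at least 1 - 2·1_A.
  have hbound : ∀ (y : ℝ) (A : Set ℝ), MeasurableSet A → γ.real A ≤ 7 / 20 →
      (∀ z, z ∉ A → pseudoLabel μ θ (y, z) * y = 1) → |y| = 1 →
      3 / 10 ≤ ∫ z, pseudoLabel μ θ (y, z) * y ∂γ := by
    intro y A hA hγ h hy
    have hind : Integrable (fun z => 1 - 2 * A.indicator (fun _ => (1 : ℝ)) z) γ :=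
      (integrable_const 1).sub (((integrable_const 1).indicator hA).const_mul 2)
    have h1 : ∫ z, (1 - 2 * A.indicator (fun _ => (1 : ℝ)) z) ∂γ = 1 - 2 * γ.real A := by
      rw [integral_sub (integrable_const 1) (((integrable_const 1).indicator hA).const_mul 2),
        integral_const_mul, integral_indicator_const _ hA]
      simp
    refine le_trans ?_ (integral_mono hind (hI y) fun z => ?_)
    · rw [h1]; linarith
    · by_cases hz : z ∈ A
      · have : |pseudoLabel μ θ (y, z) * y| = 1 := by
          rw [abs_mul, hy, pseudoLabel, abs_linearClassifier, one_mul]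
        simp only [hz, Set.indicator_of_mem]
        linarith [neg_abs_le (pseudoLabel μ θ (y, z) * y)]
      · simp [hz, h z hz]
  split_ifs
  · have h1 := hbound 1 _ measurableSet_Iic (gaussianReal_Iic_le hσ) (fun z hz => by
      rw [Set.mem_Iic, not_le] at hz
      rw [pseudoLabel_eq, if_pos (mul_nonneg hpos.le (by simp only [one_mul]; linarith)), mul_one]) (by simp)
    have h2 := hbound (-1) _ measurableSet_Ici (gaussianReal_Ici_le hσ) (fun z hz => by
      rw [Set.mem_Ici, not_le] at hz
      rw [pseudoLabel_eq, if_neg (not_le.2 (mul_neg_of_pos_of_neg hpos (by simp only [neg_mul, one_mul]; linarith)))]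
      norm_num) (by simp)
    linarith
  · simp

/-- Irrelevant terms vanish, so both mean and variance scale with |S|. The gap 3/10 - 1/4 = 1/20
gives the constant 400. -/
lemma signalCoeff_deviation {m : ℕ} {μ θ : EuclideanSpace ℝ (Fin d)} {σ : ℝ} (hσ : 0 < σ)
    (hθ : σ / 2 ≤ inner ℝ (dir θ) μ) {S : Finset (Fin m)} (hS : 0 < S.card) :
    (Measure.pi (coreLaw σ S)).real {q | signalCoeff μ θ q < S.card / (4 * m)} ≤
      400 / S.card := by
  have hS' : (0 : ℝ) < S.card := by exact_mod_cast hS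
  have hm : (0 : ℝ) < m := by
    have := S.card_le_univ
    rw [Fintype.card_fin] at this
    exact_mod_cast hS.trans_le this
  have h := chebyshev_sum_pi (memLp_label μ θ σ S) (t := S.card / 20) (by positivity)
    (V := S.card) ((Finset.sum_le_sum fun i _ => variance_label_le μ θ σ S i).trans (by simp))
  refine (measureReal_mono ?_).trans (h.trans (le_of_eq (by field_simp; norm_num)))
  intro q hq
  have hmean : (S.card : ℝ) * (3 / 10) ≤ ∑ i, ∫ q, pseudoLabel μ θ q * q.1 ∂(coreLaw σ S i) := by
    refine le_trans (le_of_eq ?_) (Finset.sum_le_sum fun i _ => le_integral_label hσ hθ S i)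
    simp
  simp only [Set.mem_ofPred_eq, signalCoeff] at hq ⊢
  have h2 : ∑ i, pseudoLabel μ θ (q i) * (q i).1 < S.card / 4 := by
    rw [inv_mul_lt_iff₀ hm] at hq
    refine hq.trans_eq ?_
    field_simp
  refine le_trans ?_ (neg_le_abs _)
  linarith

/-- The mean is nonnegative, so the coefficient falls below zero only on the fluctuation scale σ/√m.
This one-sided bound controls the loss of margin. -/
lemma dirCoeff_lower_deviation {m : ℕ} (hm : 0 < m) (μ θ : EuclideanSpace ℝ (Fin d)) {σ T : ℝ}
    (hσ : 0 < σ) (hT : 0 < T) (S : Finset (Fin m)) :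
    (Measure.pi (coreLaw σ S)).real {q | dirCoeff μ θ q < -(T * (σ / √m))} ≤ 1 / T ^ 2 := by
  have hm' : (0 : ℝ) < m := by exact_mod_cast hm
  have h := chebyshev_sum_pi (memLp_noise μ θ σ S) (t := T * σ * √m) (by positivity)
    (V := m * σ ^ 2) ((Finset.sum_le_sum fun i _ => variance_noise_le μ θ σ S i).trans (by simp))
  refine (measureReal_mono ?_).trans (h.trans (le_of_eq ?_))
  · intro q hq
    have hmean : 0 ≤ ∑ i, ∫ q, pseudoLabel μ θ q * q.2 ∂(coreLaw σ S i) :=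
      Finset.sum_nonneg fun i _ => integral_noise_nonneg μ θ σ S i
    simp only [Set.mem_ofPred_eq, dirCoeff] at hq ⊢
    rw [inv_mul_lt_iff₀ hm'] at hq
    have : (m : ℝ) * -(T * (σ / √m)) = -(T * σ * √m) := by
      nth_rewrite 1 [← Real.mul_self_sqrt hm'.le]
      field_simp
    rw [this] at hq
    refine le_trans ?_ (neg_le_abs _)
    linarith
  · rw [mul_pow, Real.sq_sqrt hm'.le]
    field_simp

/-- Cauchy–Schwarz bounds the squared coefficient by the average of the squared noises; Markov
finishes. The scale σ is natural because pseudo-labels follow the noise, so the mean itself can be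
of order σ. -/
lemma abs_dirCoeff_deviation {m : ℕ} (hm : 0 < m) (μ θ : EuclideanSpace ℝ (Fin d)) {σ T : ℝ}
    (hσ : 0 < σ) (hT : 0 < T) (S : Finset (Fin m)) :
    (Measure.pi (coreLaw σ S)).real {q | T * σ < |dirCoeff μ θ q|} ≤ 1 / T ^ 2 := by
  have hm' : (0 : ℝ) < m := by exact_mod_cast hm
  have hI : ∀ i, Integrable (fun q : Fin m → ℝ × ℝ => (q i).2 ^ 2) (Measure.pi (coreLaw σ S)) :=
    fun i => (measurePreserving_eval (coreLaw σ S) i).integrable_comp_of_integrable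
      (g := fun p : ℝ × ℝ => p.2 ^ 2) ((integrable_pow_gaussianReal 2 _).comp_snd _)
  have h := mul_meas_ge_le_integral_of_nonneg (μ := Measure.pi (coreLaw σ S))
    (f := fun q => ∑ i, (q i).2 ^ 2) (ae_of_all _ fun q => by positivity)
    (integrable_finsetSum _ fun i _ => hI i) (T ^ 2 * m * σ ^ 2)
  have hE : ∫ q, ∑ i, (q i).2 ^ 2 ∂(Measure.pi (coreLaw σ S)) = m * σ ^ 2 := by
    rw [integral_finsetSum _ fun i _ => hI i]
    have : ∀ i, ∫ q, (q i).2 ^ 2 ∂(Measure.pi (coreLaw σ S)) = σ ^ 2 := fun i => by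
      rw [integral_comp_eval (μ := coreLaw σ S) (f := fun p : ℝ × ℝ => p.2 ^ 2)
        (Measurable.aestronglyMeasurable (by fun_prop)), integral_noise_sq]
    simp [this]
  rw [hE] at h
  have hpos : 0 < m * σ ^ 2 := by positivity
  have h2 : (Measure.pi (coreLaw σ S)).real {q | T ^ 2 * m * σ ^ 2 ≤ ∑ i, (q i).2 ^ 2} ≤
      1 / T ^ 2 := by
    rw [le_div_iff₀ (by positivity)]
    refine le_of_mul_le_mul_left ?_ hpos
    linarith
  refine (measureReal_mono ?_).trans h2
  intro q hq
  simp only [Set.mem_ofPred_eq, dirCoeff] at hq ⊢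
  rw [abs_mul, abs_inv, abs_of_pos hm', lt_inv_mul_iff₀ hm'] at hq
  have hcs := sq_sum_le_card_mul_sum_sq (s := Finset.univ)
    (f := fun i => pseudoLabel μ θ (q i) * (q i).2)
  simp only [mul_pow, pseudoLabel_sq, one_mul, Finset.card_univ, Fintype.card_fin] at hcs
  have hsq : (m * (T * σ)) ^ 2 ≤ (∑ i, pseudoLabel μ θ (q i) * (q i).2) ^ 2 := by
    rw [← sq_abs (∑ i, _)]
    exact pow_le_pow_left₀ (by positivity) hq.le 2
  refine le_of_mul_le_mul_left ?_ hm'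
  nlinarith

lemma abs_signalCoeff_le {m : ℕ} (hm : 0 < m) (μ θ : EuclideanSpace ℝ (Fin d)) (σ : ℝ)
    (S : Finset (Fin m)) :
    ∀ᵐ q ∂(Measure.pi (coreLaw σ S)), |signalCoeff μ θ q| ≤ S.card / m := by
  have hm' : (0 : ℝ) < m := by exact_mod_cast hm
  have h1 : ∀ i, ∀ᵐ p ∂(coreLaw σ S i), |p.1| ≤ if i ∈ S then 1 else 0 := by
    intro i
    have : ∀ᵐ y ∂(labelLaw S i), |y| ≤ if i ∈ S then 1 else 0 := by
      unfold labelLaw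
      split_ifs
      · rw [ae_add_measure_iff]
        constructor <;> refine Measure.ae_smul_measure ?_ _ <;> simp [ae_dirac_eq]
      · simp [ae_dirac_eq]
    exact Measure.quasiMeasurePreserving_fst.ae this
  have h2 : ∀ᵐ q ∂(Measure.pi (coreLaw σ S)), ∀ i, |(q i).1| ≤ if i ∈ S then 1 else 0 :=
    ae_all_iff.2 fun i => (Measure.quasiMeasurePreserving_eval _ i).ae (h1 i)
  filter_upwards [h2] with q hq
  rw [signalCoeff, abs_mul, abs_inv, abs_of_pos hm', inv_mul_eq_div]
  gcongr
  refine (Finset.abs_sum_le_sum_abs _ _).trans ?_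
  refine (Finset.sum_le_sum fun i _ => ?_).trans_eq
    (show ∑ i, (if i ∈ S then (1 : ℝ) else 0) = S.card by simp)
  rw [abs_mul, pseudoLabel, abs_linearClassifier, one_mul]
  exact hq i

/-! ### The robust error of a linear classifier -/

lemma abs_inner_le_l1 (θ v : EuclideanSpace ℝ (Fin d)) {ε : ℝ} (hv : ∀ j, |v j| ≤ ε) :
    |inner ℝ θ v| ≤ ε * ∑ j, |θ j| := by
  rw [PiLp.inner_apply, Finset.mul_sum]
  refine (Finset.abs_sum_le_sum_abs _ _).trans (Finset.sum_le_sum fun j _ => ?_)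
  simp only [RCLike.inner_apply, conj_trivial, abs_mul]
  exact mul_le_mul_of_nonneg_right (hv j) (abs_nonneg _)

lemma l1_le_sqrt_mul_norm (θ : EuclideanSpace ℝ (Fin d)) : ∑ j, |θ j| ≤ √d * ‖θ‖ := by
  rw [EuclideanSpace.norm_eq, ← Real.sqrt_mul (by positivity)]
  refine Real.le_sqrt_of_sq_le ?_
  simpa using sq_sum_le_card_mul_sum_sq (s := Finset.univ) (f := fun j => |θ j|)

/-- The case of equality in ℓ∞–ℓ1 duality. -/
lemma exists_perturbation (θ : EuclideanSpace ℝ (Fin d)) {ε : ℝ} (hε : 0 ≤ ε) :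
    ∃ v : EuclideanSpace ℝ (Fin d), (∀ j, |v j| ≤ ε) ∧ inner ℝ θ v = ε * ∑ j, |θ j| := by
  refine ⟨WithLp.toLp 2 fun j => ε * SignType.sign (θ j), fun j => ?_, ?_⟩
  · rw [abs_mul, abs_of_nonneg hε]
    refine mul_le_of_le_one_right hε ?_
    rcases SignType.sign (θ j) <;> simp
  · rw [PiLp.inner_apply, Finset.mul_sum]
    refine Finset.sum_congr rfl fun j _ => ?_
    simp only [RCLike.inner_apply, conj_trivial]
    rw [mul_assoc, sign_mul_self]

lemma norm_pos_of_margin {θ : EuclideanSpace ℝ (Fin d)} {c x : ℝ} (h : c * ‖θ‖ < x)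
    (h0 : θ = 0 → x = 0) : 0 < ‖θ‖ := by
  rw [norm_pos_iff]
  intro hθ
  rw [h0 hθ, hθ, norm_zero, mul_zero] at h
  exact lt_irrefl _ h

lemma dataLaw_apply (μ : EuclideanSpace ℝ (Fin d)) (σ : ℝ)
    {B : Set (EuclideanSpace ℝ (Fin d) × ℝ)} (hB : MeasurableSet B) :
    dataLaw μ σ B = 2⁻¹ * isoGaussian μ σ {x | (x, (1 : ℝ)) ∈ B} +
      2⁻¹ * isoGaussian (-μ) σ {x | (x, (-1 : ℝ)) ∈ B} := by
  rw [dataLaw, Measure.add_apply, Measure.smul_apply, Measure.smul_apply, Measure.prod_dirac,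
    Measure.prod_dirac, Measure.map_apply (by fun_prop) hB, Measure.map_apply (by fun_prop) hB]
  rfl

/-- This direction holds for arbitrary sets, so the lower bound on the robust error needs no
measurability of the attack event. -/
lemma le_dataLaw_apply (μ : EuclideanSpace ℝ (Fin d)) (σ : ℝ)
    (B : Set (EuclideanSpace ℝ (Fin d) × ℝ)) :
    2⁻¹ * isoGaussian μ σ {x | (x, (1 : ℝ)) ∈ B} +
      2⁻¹ * isoGaussian (-μ) σ {x | (x, (-1 : ℝ)) ∈ B} ≤ dataLaw μ σ B := by
  rw [dataLaw, Measure.add_apply, Measure.smul_apply, Measure.smul_apply, Measure.prod_dirac,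
    Measure.prod_dirac, smul_eq_mul, smul_eq_mul]
  gcongr
  · exact Measure.le_map_apply measurable_prodMk_right.aemeasurable B
  · exact Measure.le_map_apply measurable_prodMk_right.aemeasurable B

lemma robustError_le_one (μ : EuclideanSpace ℝ (Fin d)) (σ ε : ℝ)
    (f : EuclideanSpace ℝ (Fin d) → ℝ) : robustError μ σ ε f ≤ 1 := prob_le_one

lemma ennreal_half_add_half (a : ℝ≥0∞) : 2⁻¹ * a + 2⁻¹ * a = a := by
  rw [← add_mul, ENNReal.inv_two_add_inv_two, one_mul]

/-- The attack costs at most ε√d‖θ‖ of the margin; an error then requires the score to deviate by t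
standard deviations σ‖θ‖. -/
lemma robustError_le {μ θ : EuclideanSpace ℝ (Fin d)} {σ ε t : ℝ} (hσ : 0 < σ) (hε : 0 ≤ ε)
    (ht : 0 < t) (h : (ε * √d + t * σ) * ‖θ‖ < inner ℝ θ μ) :
    robustError μ σ ε (linearClassifier θ) ≤ ENNReal.ofReal (1 / t ^ 2) := by
  have hθ : 0 < ‖θ‖ := norm_pos_of_margin h (by rintro rfl; simp)
  -- A measurable superset of the attack event; its second piece absorbs labels other than ±1, which
  -- have probability zero.
  set B : Set (EuclideanSpace ℝ (Fin d) × ℝ) :=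
    {p | p.2 * inner ℝ θ p.1 ≤ ε * √d * ‖θ‖} ∪ {p | p.2 ≠ 1 ∧ p.2 ≠ -1} with hBdef
  have hB : MeasurableSet B := by
    refine (measurableSet_le (by fun_prop) (by fun_prop)).union (MeasurableSet.inter ?_ ?_)
    · exact (measurableSet_singleton (1 : ℝ)).compl.preimage measurable_snd
    · exact (measurableSet_singleton (-1 : ℝ)).compl.preimage measurable_snd
  have hsub : {p : EuclideanSpace ℝ (Fin d) × ℝ | ∃ x' : EuclideanSpace ℝ (Fin d),
      (∀ j, |x' j - p.1 j| ≤ ε) ∧ linearClassifier θ x' ≠ p.2} ⊆ B := by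
    rintro ⟨x, y⟩ ⟨x', hx', hne⟩
    have hin : |inner ℝ θ x' - inner ℝ θ x| ≤ ε * √d * ‖θ‖ := by
      rw [← inner_sub_right]
      refine (abs_inner_le_l1 θ (x' - x) (by simpa using hx')).trans ?_
      rw [mul_assoc]
      exact mul_le_mul_of_nonneg_left (l1_le_sqrt_mul_norm θ) hε
    rw [abs_le] at hin
    by_cases hy : y = 1
    · left
      subst hy
      have : ¬ 0 ≤ inner ℝ θ x' := fun h => hne (by simp [linearClassifier, h])
      simp only [Set.mem_ofPred_eq, one_mul]
      linarith
    by_cases hy' : y = -1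
    · left
      subst hy'
      have : 0 ≤ inner ℝ θ x' := by
        by_contra h
        exact hne (by simp [linearClassifier, h])
      simp only [Set.mem_ofPred_eq]
      linarith
    · exact Or.inr ⟨hy, hy'⟩
  have key : ∀ (v : EuclideanSpace ℝ (Fin d)) (A : Set (EuclideanSpace ℝ (Fin d))),
      (∀ x ∈ A, t * (σ * ‖θ‖) ≤ |inner ℝ θ x - inner ℝ θ v|) →
      isoGaussian v σ A ≤ ENNReal.ofReal (1 / t ^ 2) := by
    intro v A hA
    rw [← ofReal_measureReal]
    exact ENNReal.ofReal_le_ofReal ((measureReal_mono hA).trans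
      (isoGaussian_inner_deviation v θ ht hσ hθ le_rfl))
  refine (measure_mono hsub).trans ?_
  rw [dataLaw_apply μ σ hB, ← ennreal_half_add_half (ENNReal.ofReal (1 / t ^ 2))]
  gcongr
  · refine key μ _ fun x hx => le_trans ?_ (neg_le_abs _)
    simp [hBdef] at hx
    linarith
  · refine key (-μ) _ fun x hx => le_trans ?_ (le_abs_self _)
    have h1 : ¬ (-1 : ℝ) = 1 := by norm_num
    simp [hBdef, h1] at hx
    rw [inner_neg_right]
    linarith

/-- One fixed perturbation, subtracted for label 1 and added for label -1, flips the prediction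
unless the score deviates by t standard deviations. -/
lemma le_robustError {μ θ : EuclideanSpace ℝ (Fin d)} {σ ε t : ℝ} (hσ : 0 < σ) (hε : 0 ≤ ε)
    (ht : 0 < t) (h : t * σ * ‖θ‖ < ε * ∑ j, |θ j| - inner ℝ θ μ) :
    ENNReal.ofReal (1 - 1 / t ^ 2) ≤ robustError μ σ ε (linearClassifier θ) := by
  have hθ : 0 < ‖θ‖ := norm_pos_of_margin h (by rintro rfl; simp)
  obtain ⟨w, hw, hθw⟩ := exists_perturbation θ hε
  have key : ∀ (v : EuclideanSpace ℝ (Fin d)) (A : Set (EuclideanSpace ℝ (Fin d))),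
      (∀ x, |inner ℝ θ x - inner ℝ θ v| < t * (σ * ‖θ‖) → x ∈ A) →
      ENNReal.ofReal (1 - 1 / t ^ 2) ≤ isoGaussian v σ A := by
    intro v A hA
    have h1 := isoGaussian_inner_deviation v θ ht hσ hθ le_rfl
    have hm : MeasurableSet {x | t * (σ * ‖θ‖) ≤ |inner ℝ θ x - inner ℝ θ v|} :=
      measurableSet_le (by fun_prop) (by fun_prop)
    have h2 := probReal_compl_eq_one_sub (μ := isoGaussian v σ) hm
    rw [← ofReal_measureReal]
    refine ENNReal.ofReal_le_ofReal (le_trans ?_ (measureReal_mono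
      (s₁ := {x | t * (σ * ‖θ‖) ≤ |inner ℝ θ x - inner ℝ θ v|}ᶜ) fun x hx => hA x (not_le.1 hx)))
    linarith
  refine le_trans ?_ (le_dataLaw_apply μ σ _)
  rw [← ennreal_half_add_half (ENNReal.ofReal (1 - 1 / t ^ 2))]
  gcongr
  · refine key μ _ fun x hx => ⟨x - w, fun j => by simpa using hw j, ?_⟩
    have : ¬ 0 ≤ inner ℝ θ (x - w) := by
      rw [inner_sub_right, hθw]
      linarith [(abs_lt.1 hx).2]
    rw [linearClassifier, if_neg this]
    norm_num
  · refine key (-μ) _ fun x hx => ⟨x + w, fun j => by simpa using hw j, ?_⟩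
    have : 0 ≤ inner ℝ θ (x + w) := by
      rw [inner_add_right, hθw]
      rw [inner_neg_right] at hx
      linarith [(abs_lt.1 hx).1]
    rw [linearClassifier, if_pos this]
    norm_num

/-! ### From success probabilities to expected robust errors -/

lemma prod_real_le {α β : Type*} [MeasurableSpace α] [MeasurableSpace β] (P : Measure α)
    (Q : Measure β) [IsProbabilityMeasure P] [IsProbabilityMeasure Q] {A : Set α} {B : Set β}
    {E : Set (α × β)} (h : ∀ p ∈ E, p.1 ∈ A ∨ p.2 ∈ B) :
    (P.prod Q).real E ≤ P.real A + Q.real B := by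
  have hsub : E ⊆ A ×ˢ Set.univ ∪ Set.univ ×ˢ B := fun p hp =>
    (h p hp).imp (fun h => ⟨h, trivial⟩) fun h => ⟨trivial, h⟩
  refine (measureReal_mono hsub).trans ((measureReal_union_le _ _).trans_eq ?_)
  simp [measureReal_prod_prod]

lemma pseudoLabeled_failure_le {m : ℕ} (hm : 0 < m) (μ θ : EuclideanSpace ℝ (Fin d)) (σ : ℝ)
    (S : Finset (Fin m)) {G : Set (EuclideanSpace ℝ (Fin d))} (hG : MeasurableSet G) {p : ℝ}
    (h : ((Measure.pi (coreLaw σ S)).prod (isoGaussian 0 (σ / √m))).real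
      {p | signalCoeff μ θ p.1 • μ + dirCoeff μ θ p.1 • dir θ + perp (dir θ) p.2 ∉ G} ≤ p) :
    unlabeledLaw μ σ S {u | supervisedEstimator (fun i => (u i, linearClassifier θ (u i))) ∉ G} ≤
      ENNReal.ofReal p := by
  have hmeas : Measurable fun p : (Fin m → ℝ × ℝ) × EuclideanSpace ℝ (Fin d) =>
      signalCoeff μ θ p.1 • μ + dirCoeff μ θ p.1 • dir θ + perp (dir θ) p.2 := by fun_prop
  have h1 := Measure.map_apply (μ := unlabeledLaw μ σ S)
    (measurable_supervisedEstimator_pseudoLabeled θ) hG.compl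
  rw [unlabeledLaw_map hm, Measure.map_apply hmeas hG.compl, ← ofReal_measureReal] at h1
  exact h1.symm.le.trans (ENNReal.ofReal_le_ofReal h)

/-- Fubini over the labeled sample: failure costs at most 1 when the first-stage estimator misses H,
and p₂ otherwise. -/
lemma selfTraining_failure_le {n m : ℕ} (hn : 0 < n) (hm : 0 < m)
    (μ : EuclideanSpace ℝ (Fin d)) (σ : ℝ) (S : Finset (Fin m))
    {G H : Set (EuclideanSpace ℝ (Fin d))} (hG : MeasurableSet G) (hH : MeasurableSet H)
    {p₁ p₂ : ℝ} (h₁ : (isoGaussian μ (σ / √n)).real Hᶜ ≤ p₁)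
    (h₂ : ∀ θ ∈ H, ((Measure.pi (coreLaw σ S)).prod (isoGaussian 0 (σ / √m))).real
      {p | signalCoeff μ θ p.1 • μ + dirCoeff μ θ p.1 • dir θ + perp (dir θ) p.2 ∉ G} ≤ p₂) :
    (((labeledLaw μ σ n).prod (unlabeledLaw μ σ S)).map
      fun z => selfTrainingEstimator z.1 z.2) Gᶜ ≤ ENNReal.ofReal p₁ + ENNReal.ofReal p₂ := by
  have hest := measurable_selfTrainingEstimator (d := d) (n := n) (m := m)
  have hsup := measurable_supervisedEstimator (d := d) (n := n)
  rw [Measure.map_apply hest hG.compl, Measure.prod_apply (hest hG.compl)]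
  have hstep : ∀ s : Fin n → EuclideanSpace ℝ (Fin d) × ℝ,
      unlabeledLaw μ σ S (Prod.mk s ⁻¹' ((fun z => selfTrainingEstimator z.1 z.2) ⁻¹' Gᶜ)) ≤
      (supervisedEstimator ⁻¹' Hᶜ).indicator 1 s + ENNReal.ofReal p₂ := by
    intro s
    by_cases hs : supervisedEstimator s ∈ H
    · exact (pseudoLabeled_failure_le hm μ _ σ S hG (h₂ _ hs)).trans le_add_self
    · rw [Set.indicator_of_mem (by simpa using hs)]
      exact prob_le_one.trans le_self_add
  refine (lintegral_mono hstep).trans ?_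
  rw [lintegral_add_right _ measurable_const, lintegral_indicator_one (hsup hH.compl),
    lintegral_const, measure_univ, mul_one]
  gcongr
  rw [← Measure.map_apply hsup hH.compl, labeledLaw_map_supervisedEstimator hn,
    ← ofReal_measureReal]
  exact ENNReal.ofReal_le_ofReal h₁

lemma expectedRobustError_le {n m : ℕ} {μ : EuclideanSpace ℝ (Fin d)} {σ ε : ℝ}
    {S : Finset (Fin m)} {G : Set (EuclideanSpace ℝ (Fin d))} (hG : MeasurableSet G) {δ p : ℝ≥0∞}
    (hδ : ∀ θ ∈ G, robustError μ σ ε (linearClassifier θ) ≤ δ)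
    (hp : (((labeledLaw μ σ n).prod (unlabeledLaw μ σ S)).map
      fun z => selfTrainingEstimator z.1 z.2) Gᶜ ≤ p) :
    expectedRobustError μ σ ε n S ≤ δ + p := by
  have hest := measurable_selfTrainingEstimator (d := d) (n := n) (m := m)
  rw [Measure.map_apply hest hG.compl] at hp
  refine (lintegral_mono (g := fun z => δ +
    ((fun z => selfTrainingEstimator z.1 z.2) ⁻¹' Gᶜ).indicator 1 z) fun z => ?_).trans ?_
  · by_cases hz : selfTrainingEstimator z.1 z.2 ∈ G
    · exact (hδ _ hz).trans le_self_add
    · have : z ∈ (fun z => selfTrainingEstimator z.1 z.2) ⁻¹' Gᶜ := hz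
      simp only [Set.indicator_of_mem this]
      exact (robustError_le_one _ _ _ _).trans le_add_self
  · rw [lintegral_add_left measurable_const, lintegral_indicator_one (hest hG.compl),
      lintegral_const, measure_univ, mul_one]
    gcongr

lemma le_expectedRobustError {n m : ℕ} {μ : EuclideanSpace ℝ (Fin d)} {σ ε : ℝ}
    {S : Finset (Fin m)} {G : Set (EuclideanSpace ℝ (Fin d))} (hG : MeasurableSet G) {δ p : ℝ≥0∞}
    (hδ : ∀ θ ∈ G, δ ≤ robustError μ σ ε (linearClassifier θ))
    (hp : (((labeledLaw μ σ n).prod (unlabeledLaw μ σ S)).map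
      fun z => selfTrainingEstimator z.1 z.2) Gᶜ ≤ p) :
    δ * (1 - p) ≤ expectedRobustError μ σ ε n S := by
  have hest := measurable_selfTrainingEstimator (d := d) (n := n) (m := m)
  have : IsProbabilityMeasure (((labeledLaw μ σ n).prod (unlabeledLaw μ σ S)).map
      fun z => selfTrainingEstimator z.1 z.2) := Measure.isProbabilityMeasure_map hest.aemeasurable
  have h1 : 1 - p ≤ (((labeledLaw μ σ n).prod (unlabeledLaw μ σ S)).map
      fun z => selfTrainingEstimator z.1 z.2) G := by
    rw [← compl_compl G, prob_compl_eq_one_sub hG.compl]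
    exact tsub_le_tsub_left hp 1
  rw [Measure.map_apply hest hG] at h1
  refine le_trans ?_ (lintegral_mono (f := ((fun z => selfTrainingEstimator z.1 z.2) ⁻¹' G).indicator
    fun _ => δ) fun z => ?_)
  · rw [lintegral_indicator_const (hest hG)]
    gcongr
  · by_cases hz : selfTrainingEstimator z.1 z.2 ∈ G
    · rw [Set.indicator_of_mem (by simpa using hz)]
      exact hδ _ hz
    · rw [Set.indicator_of_notMem (by simpa using hz)]
      exact zero_le

/-! ### Margins of the self-training estimator -/

lemma inner_combination (μ u g : EuclideanSpace ℝ (Fin d)) (b A : ℝ) :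
    inner ℝ (b • μ + A • u + perp u g) μ =
      b * ‖μ‖ ^ 2 + A * inner ℝ u μ + inner ℝ (perp u μ) g := by
  rw [inner_add_left, inner_add_left, inner_perp_left, inner_smul_left, inner_smul_left,
    real_inner_self_eq_norm_sq, real_inner_comm g]
  simp

lemma norm_combination_le {u : EuclideanSpace ℝ (Fin d)} (hu : u = 0 ∨ ‖u‖ = 1)
    (μ g : EuclideanSpace ℝ (Fin d)) (b A : ℝ) :
    ‖b • μ + A • u + perp u g‖ ≤ |b| * ‖μ‖ + |A| + ‖g‖ := by
  have hu1 : ‖u‖ ≤ 1 := by rcases hu with h | h <;> simp [h]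
  refine (norm_add₃_le).trans ?_
  rw [norm_smul, norm_smul, Real.norm_eq_abs, Real.norm_eq_abs]
  gcongr
  · exact mul_le_of_le_one_right (abs_nonneg _) hu1
  · exact norm_perp_le hu g

/-- The deterministic part of the upper bound: with enough unlabeled data the self-training
estimator has a large margin. -/
lemma large_margin {μ u g : EuclideanSpace ℝ (Fin d)} (hu : u = 0 ∨ ‖u‖ = 1)
    {b A α ε σ k L : ℝ} (hk : 0 < k) (hε : 0 < ε) (hε2 : ε ≤ 1 / 2) (hσ : 0 < σ) (hL : 0 < L)
    (hμ : ‖μ‖ = σ * k) (hkσ : k ≤ σ) (hα : 0 < α) (hαk : 10 ^ 4 ≤ α * k) (hεk : 7000 ≤ ε * k)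
    (hLα : 16.9 * ε * L ≤ α) (huμ : 0 ≤ inner ℝ u μ)
    (hb : α / 4 ≤ b) (hA : -(100 * L) ≤ A) (hA' : |A| ≤ 100 * σ)
    (hg : ‖g‖ ^ 2 ≤ 2 * (σ * k) ^ 2 * L ^ 2) (hgμ : |inner ℝ (perp u μ) g| ≤ 100 * (L * (σ * k))) :
    11 / 10 * ε * (σ * k) * ‖b • μ + A • u + perp u g‖ <
      inner ℝ (b • μ + A • u + perp u g) μ := by
  have hnorm := norm_combination_le hu μ g b A
  have hb0 : 0 < b := by linarith
  rw [inner_combination, hμ]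
  rw [hμ, abs_of_pos hb0] at hnorm
  set D := σ * k with hD
  have hD0 : 0 < D := by positivity
  have hu1 : ‖u‖ ≤ 1 := by rcases hu with h | h <;> simp [h]
  have huD : inner ℝ u μ ≤ D := by
    refine (real_inner_le_norm u μ).trans ?_
    rw [hμ]
    exact mul_le_of_le_one_left hD0.le hu1
  -- Here 3/2 is a rational stand-in for √2.
  have hg1 : ‖g‖ ≤ 3 / 2 * (D * L) := by
    refine abs_le_of_sq_le_sq' ?_ (by positivity) |>.2
    nlinarith [sq_nonneg (D * L)]
  -- the noise along `u` is negligible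
  have hAu : -(100 * L * D) ≤ A * inner ℝ u μ := by
    rcases le_total 0 A with h | h
    · have := mul_nonneg h huμ
      have : 0 ≤ 100 * L * D := by positivity
      linarith
    · nlinarith
  have hεL : ε * L ≤ b * (4 / 16.9) := by linarith
  have hεD : 7000 ≤ ε * D := by
    have : ε * k * 1 ≤ ε * k * σ := by
      refine mul_le_mul_of_nonneg_left ?_ (by positivity)
      by_contra! hlt
      nlinarith
    have : ε * D = ε * k * σ := by rw [hD]; ring
    linarith
  have hLD : L * 7000 ≤ b * (4 / 16.9) * D := by
    calc L * 7000 ≤ L * (ε * D) := by gcongr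
      _ = ε * L * D := by ring
      _ ≤ _ := by gcongr
  have hσb : 100 * σ ≤ b * D / 25 := by
    have : σ * 10 ^ 4 ≤ σ * (α * k) := by gcongr
    have h2 : σ * (α * k) ≤ 4 * b * D := by
      rw [hD]
      have := mul_le_mul_of_nonneg_right hb (by positivity : 0 ≤ σ * k)
      linarith
    linarith
  have hlow : b * D ^ 2 * (99 / 100) ≤ b * D ^ 2 + A * inner ℝ u μ + inner ℝ (perp u μ) g := by
    have h1 := (abs_le.1 hgμ).1
    have h2 : L * 7000 * D ≤ b * (4 / 16.9) * D * D := by gcongr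
    have h3 : 0 < b * D ^ 2 := by positivity
    nlinarith
  -- The mean and A-terms use ε ≤ 1/2, the Gaussian term uses εL ≤ 4b/16.9: 0.52 + 6/16.9 < 0.88,
  -- and 1.1 · 0.88 < 0.99 leaves the strict margin.
  have hup : ε * ‖b • μ + A • u + perp u g‖ ≤ b * D * (88 / 100) := by
    have hbD : 0 < b * D := by positivity
    calc ε * ‖b • μ + A • u + perp u g‖
        ≤ ε * (b * D + 100 * σ + 3 / 2 * (D * L)) := by gcongr; linarith
      _ ≤ ε * (b * D + b * D / 25) + 3 / 2 * D * (ε * L) := by nlinarith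
      _ ≤ 1 / 2 * (b * D + b * D / 25) + 3 / 2 * D * (b * (4 / 16.9)) := by gcongr
      _ ≤ _ := by linarith
  calc 11 / 10 * ε * D * ‖b • μ + A • u + perp u g‖
      = 11 / 10 * D * (ε * ‖b • μ + A • u + perp u g‖) := by ring
    _ ≤ 11 / 10 * D * (b * D * (88 / 100)) := by gcongr
    _ < b * D ^ 2 * (99 / 100) := by
        have h3 : 0 < b * D ^ 2 := by positivity
        linarith
    _ ≤ _ := hlow

/-- Solve for g in the combination and apply the triangle inequality coordinatewise; terms along the
single direction u cost only √d, against order d for the ℓ1 norm of g. -/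
lemma l1_perp_le {u : EuclideanSpace ℝ (Fin d)} (μ g : EuclideanSpace ℝ (Fin d)) (b A : ℝ)
    (hu : ‖u‖ ≤ 1) :
    ∑ j, |g j| ≤ ∑ j, |(b • μ + A • u + perp u g) j| + |b| * ∑ j, |μ j| +
      (|A| + |inner ℝ u g|) * √d := by
  have h1 : ∑ j, |u j| ≤ √d :=
    (l1_le_sqrt_mul_norm u).trans (mul_le_of_le_one_right (Real.sqrt_nonneg _) hu)
  have h2 : ∑ j, |g j| ≤ ∑ j, |(b • μ + A • u + perp u g) j| + |b| * ∑ j, |μ j| +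
      (|A| + |inner ℝ u g|) * ∑ j, |u j| := by
    rw [Finset.mul_sum, Finset.mul_sum, ← Finset.sum_add_distrib, ← Finset.sum_add_distrib]
    refine Finset.sum_le_sum fun j _ => ?_
    have : g j = (b • μ + A • u + perp u g) j - b * μ j - A * u j + inner ℝ u g * u j := by
      simp [perp]
      ring
    rw [this, add_mul, ← abs_mul, ← abs_mul, ← abs_mul]
    refine (abs_add_le _ _).trans ?_
    have h3 := abs_sub ((b • μ + A • u + perp u g) j - b * μ j) (A * u j)
    have h4 := abs_sub ((b • μ + A • u + perp u g) j) (b * μ j)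
    linarith
  refine h2.trans ?_
  gcongr

/-- The deterministic part of the lower bound: with too little unlabeled data the `ℓ_∞` attack
beats the margin of the self-training estimator. -/
lemma small_margin {μ u g : EuclideanSpace ℝ (Fin d)} (hu : u = 0 ∨ ‖u‖ = 1)
    {b A α ε σ k L : ℝ} (hk : 0 < k) (hε : 0 < ε) (hε2 : ε ≤ 1 / 2) (hσ : 0 < σ) (hL : 0 < L)
    (hd : √d = σ * k) (hμ : ‖μ‖ = √d) (hkσ : k ≤ σ)
    (hαk : 10 ^ 4 ≤ α * k) (hεk : 7000 ≤ ε * k) (hLα : α ≤ 1 / 100 * ε * L)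
    (hb : |b| ≤ α) (hA : |A| ≤ 10 * σ)
    (hg : ‖g‖ ^ 2 ≤ 2 * (σ * k) ^ 2 * L ^ 2) (hgμ : |inner ℝ (perp u μ) g| ≤ 10 * (L * (σ * k)))
    (hgu : |inner ℝ u g| ≤ 10 * L) (hg1 : (σ * k) ^ 2 * L / 2 ≤ ∑ j, |g j|) :
    10 * σ * ‖b • μ + A • u + perp u g‖ <
      ε * ∑ j, |(b • μ + A • u + perp u g) j| - inner ℝ (b • μ + A • u + perp u g) μ := by
  have hnorm := norm_combination_le hu μ g b A
  have hu1 : ‖u‖ ≤ 1 := by rcases hu with h | h <;> simp [h]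
  have hl1 := l1_perp_le μ g b A hu1
  have hμ1 := l1_le_sqrt_mul_norm μ
  rw [inner_combination]
  rw [hd] at hμ hμ1 hl1
  rw [hμ] at hμ1 hnorm ⊢
  set D := σ * k with hD
  set θ := b • μ + A • u + perp u g
  have hD0 : 0 < D := by positivity
  have hX : 0 < ε * (D ^ 2 * L) := by positivity
  have huD : |inner ℝ u μ| ≤ D := by
    refine (abs_real_inner_le_norm u μ).trans ?_
    rw [hμ]
    exact mul_le_of_le_one_left hD0.le hu1
  have hg2 : ‖g‖ ≤ 3 / 2 * (D * L) := by
    refine abs_le_of_sq_le_sq' ?_ (by positivity) |>.2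
    nlinarith [sq_nonneg (D * L)]
  have hσ1 : 1 ≤ σ := by
    by_contra! hlt
    nlinarith
  have hεD : 7000 ≤ ε * D := by
    have : ε * k * 1 ≤ ε * k * σ := by gcongr
    have : ε * D = ε * k * σ := by rw [hD]; ring
    linarith
  have hσD : σ * 7000 ≤ ε * D := by
    calc σ * 7000 ≤ σ * (ε * k) := by gcongr
      _ = ε * D := by rw [hD]; ring
  have hαD : α * D ^ 2 ≤ 1 / 100 * (ε * (D ^ 2 * L)) := by
    calc α * D ^ 2 ≤ 1 / 100 * ε * L * D ^ 2 := by gcongr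
      _ = _ := by ring
  have hσL : σ * 10 ^ 6 ≤ ε * (D * L) := by
    have h1 : σ * 10 ^ 4 ≤ σ * (α * k) := by gcongr
    have h2 : σ * (α * k) ≤ D * (1 / 100 * ε * L) := by
      calc σ * (α * k) = D * α := by rw [hD]; ring
        _ ≤ _ := by gcongr
    linarith
  have hσDL : σ * D * 10 ^ 6 ≤ ε * (D ^ 2 * L) := by
    calc σ * D * 10 ^ 6 = σ * 10 ^ 6 * D := by ring
      _ ≤ ε * (D * L) * D := by gcongr
      _ = _ := by ring
  have hLD : L * D * 7000 ≤ ε * (D ^ 2 * L) := by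
    calc L * D * 7000 ≤ L * D * (ε * D) := by gcongr
      _ = _ := by ring
  have hbD : |b| * D ≤ α * D := by gcongr
  -- the three quantities in the claim
  have hinner : b * D ^ 2 + A * inner ℝ u μ + inner ℝ (perp u μ) g ≤
      1 / 50 * (ε * (D ^ 2 * L)) := by
    have h1 : b * D ^ 2 ≤ α * D ^ 2 := by gcongr; exact (le_abs_self b).trans hb
    have h2 : A * inner ℝ u μ ≤ 10 * σ * D := by
      refine (le_abs_self _).trans ?_
      rw [abs_mul]
      gcongr
    have h3 := (abs_le.1 hgμ).2
    linarith
  have hsum : 2 / 5 * (D ^ 2 * L) ≤ ∑ j, |θ j| := by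
    have hα : 0 ≤ α := (abs_nonneg b).trans hb
    have h1 : |b| * ∑ j, |μ j| ≤ α * D ^ 2 := by
      calc |b| * ∑ j, |μ j| ≤ α * (D * D) := by gcongr
        _ = _ := by ring
    have h2 : (|A| + |inner ℝ u g|) * D ≤ (10 * σ + 10 * L) * D := by gcongr
    have h3 : ε * (D ^ 2 * L) ≤ 1 / 2 * (D ^ 2 * L) := by gcongr
    linarith
  have hθ : σ * ‖θ‖ ≤ 2 * (σ * (D * L)) := by
    have h1 : α * D ≤ 1 / 100 * (1 / 2) * L * D := by
      refine mul_le_mul_of_nonneg_right (hLα.trans ?_) hD0.le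
      gcongr
    have h2 : σ ≤ 1 / 10 ^ 6 * (1 / 2 * (D * L)) := by
      have : ε * (D * L) ≤ 1 / 2 * (D * L) := by gcongr
      linarith
    have h4 : 0 < D * L := by positivity
    have h3 : ‖θ‖ ≤ 2 * (D * L) := by linarith
    calc σ * ‖θ‖ ≤ σ * (2 * (D * L)) := by gcongr
      _ = _ := by ring
  have hσDL' : σ * (D * L) * 7000 ≤ ε * (D ^ 2 * L) := by
    calc σ * (D * L) * 7000 = σ * 7000 * (D * L) := by ring
      _ ≤ ε * D * (D * L) := by gcongr
      _ = _ := by ring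
  have hfin : ε * (2 / 5 * (D ^ 2 * L)) ≤ ε * ∑ j, |θ j| := by gcongr
  linarith

/-! ### The scaling regime -/

/-- The scale is k = (d/n₀)^(1/4), which turns the regime condition into lower bounds on αk and εk.
-/
lemma exists_scale {d n₀ : ℕ} {ε α σ : ℝ} (hd : 2 ≤ d) (hn₀ : 1 ≤ n₀) (hε : 0 < ε) (hα : 0 < α)
    (hσ : σ = ((n₀ : ℝ) * d) ^ (1 / 4 : ℝ))
    (hr : 10 ^ 8 < min (ε ^ 2 / Real.log d) (α ^ 2) * √((d : ℝ) / n₀)) :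
    ∃ k : ℝ, 0 < k ∧ 0 < σ ∧ √(d : ℝ) = σ * k ∧ σ ^ 2 = n₀ * k ^ 2 ∧ √((d : ℝ) / n₀) = k ^ 2 ∧
      10 ^ 4 ≤ α * k ∧ 7000 ≤ ε * k := by
  have hd' : (2 : ℝ) ≤ d := by exact_mod_cast hd
  have hn' : (1 : ℝ) ≤ n₀ := by exact_mod_cast hn₀
  set K := √((d : ℝ) / n₀) with hK
  have hK0 : 0 < K := Real.sqrt_pos.2 (by positivity)
  have hK2 : K ^ 2 = d / n₀ := Real.sq_sqrt (by positivity)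
  have hk2 : √K ^ 2 = K := Real.sq_sqrt hK0.le
  have hk0 : 0 < √K := Real.sqrt_pos.2 hK0
  have hσ0 : 0 < σ := by rw [hσ]; positivity
  have hσ4 : σ ^ 4 = n₀ * d := by
    rw [hσ, ← Real.rpow_natCast, ← Real.rpow_mul (by positivity)]
    norm_num
  have hσ2 : σ ^ 2 = n₀ * K := by
    rw [← sq_eq_sq₀ (by positivity) (by positivity), ← pow_mul, hσ4, mul_pow, hK2]
    field_simp
  -- Only log d ≥ log 2 is used: 7000² ≤ 0.69 · 10⁸.
  have hlog : 69 / 100 ≤ Real.log d := by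
    have := Real.log_le_log (by norm_num) hd'
    linarith [Real.log_two_gt_d9]
  refine ⟨√K, hk0, hσ0, ?_, by rw [hk2, hσ2], hk2.symm, ?_, ?_⟩
  · rw [Real.sqrt_eq_iff_mul_self_eq (by positivity) (by positivity)]
    symm
    calc σ * √K * (σ * √K) = σ ^ 2 * √K ^ 2 := by ring
      _ = n₀ * K ^ 2 := by rw [hσ2, hk2]; ring
      _ = d := by rw [hK2]; field_simp
  · refine abs_le_of_sq_le_sq' ?_ (by positivity) |>.2
    rw [mul_pow, hk2]
    have : min (ε ^ 2 / Real.log d) (α ^ 2) * K ≤ α ^ 2 * K := by gcongr; exact min_le_right _ _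
    linarith
  · refine abs_le_of_sq_le_sq' ?_ (by positivity) |>.2
    rw [mul_pow, hk2]
    have h1 : min (ε ^ 2 / Real.log d) (α ^ 2) * K ≤ ε ^ 2 / Real.log d * K := by
      gcongr; exact min_le_left _ _
    have h2 : ε ^ 2 / Real.log d * K = ε ^ 2 * K / Real.log d := by ring
    have h3 : 10 ^ 8 < ε ^ 2 * K / Real.log d := by linarith
    rw [lt_div_iff₀ (by linarith)] at h3
    linarith

lemma isoGaussian_norm_sub_sq_deviation (hd : 0 < d) (μ : EuclideanSpace ℝ (Fin d)) (τ : ℝ) :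
    (isoGaussian μ τ).real {x | 2 * d * τ ^ 2 < ‖x - μ‖ ^ 2} ≤ 2 / d := by
  have h := isoGaussian_map_add_smul (0 : EuclideanSpace ℝ (Fin d)) τ 1 μ
  simp only [one_smul, add_zero, one_mul] at h
  rw [← h, map_measureReal_apply (by fun_prop) (measurableSet_lt (by fun_prop) (by fun_prop))]
  simpa using isoGaussian_norm_sq_deviation hd τ

lemma measurable_dir : Measurable (dir : EuclideanSpace ℝ (Fin d) → _) := by
  unfold dir; fun_prop

/-- The direction of the supervised estimator is correlated with the mean. -/
lemma supervised_direction {μ : EuclideanSpace ℝ (Fin d)} (hd : 0 < d) {σ k τ : ℝ} (hk : 0 < k)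
    (hσk : √(d : ℝ) = σ * k) (hμ : ‖μ‖ = σ * k) (hσ : 10 ^ 4 ≤ σ) (hk' : 10 ^ 4 ≤ k) (hτ : 0 < τ)
    (hτk : τ ≤ k) :
    (isoGaussian μ τ).real {θ | σ / 2 ≤ inner ℝ (dir θ) μ}ᶜ ≤ 1 / 100 ^ 2 + 2 / d := by
  have hσ0 : 0 < σ := by linarith
  have hD : 0 < σ * k := by positivity
  have hd2 : (d : ℝ) = (σ * k) ^ 2 := by rw [← hσk, Real.sq_sqrt (by positivity)]
  have h1 := isoGaussian_inner_deviation μ μ (T := 100) (by norm_num) hτ hD hμ.le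
  have h2 := isoGaussian_norm_sub_sq_deviation hd μ τ
  refine (measureReal_mono ?_).trans ((measureReal_union_le _ _).trans (add_le_add h1 h2))
  intro θ hθ
  by_contra hcon
  simp only [Set.mem_union, Set.mem_ofPred_eq, not_or, not_le, not_lt] at hcon
  obtain ⟨hc1, hc2⟩ := hcon
  refine hθ ?_
  have hkσ2 : 0 < σ * k ^ 2 := by positivity
  -- The noise norm, of order √d·k, dominates ‖μ‖ = √d. With ⟨θ, μ⟩ ≥ 0.99 d and ‖θ‖ ≤ 1.6 σk² the
  -- correlation is at least 0.61 σ.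
  have hdiff : ‖θ - μ‖ ≤ 3 / 2 * (σ * k) * k := by
    refine abs_le_of_sq_le_sq' ?_ (by positivity) |>.2
    rw [hd2] at hc2
    have : (σ * k) ^ 2 * τ ^ 2 ≤ (σ * k) ^ 2 * k ^ 2 := by gcongr
    have : 0 ≤ (σ * k) ^ 2 * k ^ 2 := by positivity
    linarith
  have hnorm : ‖θ‖ ≤ 8 / 5 * (σ * k ^ 2) := by
    have h3 : ‖θ‖ ≤ ‖μ‖ + ‖θ - μ‖ := by simpa using norm_add_le μ (θ - μ)
    have h4 : σ * k * 10 ^ 4 ≤ σ * k * k := by gcongr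
    rw [hμ] at h3
    linarith
  have hinner : 99 / 100 * (σ ^ 2 * k ^ 2) ≤ inner ℝ θ μ := by
    rw [real_inner_self_eq_norm_sq, hμ, real_inner_comm] at hc1
    have h3 := (abs_lt.1 hc1).1
    have h4 : 100 * (τ * (σ * k)) ≤ 100 * (k * (σ * k)) := by gcongr
    have h5 : 10 ^ 4 * (σ * k ^ 2) ≤ σ * (σ * k ^ 2) := by gcongr
    linarith
  have hpos : 0 < ‖θ‖ := by
    rw [norm_pos_iff]
    rintro rfl
    rw [inner_zero_left] at hinner
    have : 0 < σ ^ 2 * k ^ 2 := by positivity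
    linarith
  rw [inner_eq_norm_mul_dir] at hinner
  refine le_of_mul_le_mul_left (le_trans ?_ hinner) hpos
  calc ‖θ‖ * (σ / 2) ≤ 8 / 5 * (σ * k ^ 2) * (σ / 2) := by gcongr
    _ ≤ _ := by
      have : 0 < σ ^ 2 * k ^ 2 := by positivity
      linarith

lemma isoGaussian_zero_inner_deviation (θ : EuclideanSpace ℝ (Fin d)) {σ T N : ℝ} (hT : 0 < T)
    (hσ : 0 < σ) (hN : 0 < N) (hθ : ‖θ‖ ≤ N) :
    (isoGaussian 0 σ).real {x | T * (σ * N) < |inner ℝ θ x|} ≤ 1 / T ^ 2 := by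
  refine (measureReal_mono fun x hx => ?_).trans
    (isoGaussian_inner_deviation (0 : EuclideanSpace ℝ (Fin d)) θ hT hσ hN hθ)
  simpa using le_of_lt hx

/-! ### Upper and lower bounds on the expected robust error -/

lemma expectedRobustError_upper {n m : ℕ} {μ : EuclideanSpace ℝ (Fin d)} {ε α σ k : ℝ}
    {S : Finset (Fin m)} (hd : 0 < d) (hn : 0 < n) (hm : 0 < m) (hε : 0 < ε) (hε2 : ε ≤ 1 / 2)
    (hα : 0 < α) (hα1 : α < 1) (hS : (S.card : ℝ) = α * m) (hk : 0 < k) (hσ : 0 < σ)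
    (hσk : √(d : ℝ) = σ * k) (hμ : ‖μ‖ = σ * k) (hkσ : k ≤ σ) (hσn : σ / √n ≤ k)
    (hαk : 10 ^ 4 ≤ α * k) (hεk : 7000 ≤ ε * k) (hmα : 288 * ε ^ 2 * σ ^ 2 ≤ α ^ 2 * m) :
    expectedRobustError μ σ ε n S ≤ ENNReal.ofReal (1 / 1000) := by
  have hm' : (0 : ℝ) < m := by exact_mod_cast hm
  have hn' : (0 : ℝ) < n := by exact_mod_cast hn
  have hsm : 0 < √(m : ℝ) := Real.sqrt_pos.2 hm'
  have hd2 : (d : ℝ) = (σ * k) ^ 2 := by rw [← hσk, Real.sq_sqrt (by positivity)]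
  have hk4 : 10 ^ 4 ≤ k := hαk.trans (mul_le_of_le_one_left hk.le hα1.le)
  have hσ4 : 10 ^ 4 ≤ σ := hk4.trans hkσ
  have hD : 0 < σ * k := by positivity
  set L := σ / √m with hLdef
  have hL : 0 < L := by positivity
  -- Source of the constant 288: 16.9² = 285.61.
  have hLα : 16.9 * ε * L ≤ α := by
    refine abs_le_of_sq_le_sq' ?_ hα.le |>.2
    rw [hLdef, mul_pow, div_pow, Real.sq_sqrt hm'.le, mul_pow, ← mul_div_assoc, div_le_iff₀ hm']
    have : 0 < ε ^ 2 * σ ^ 2 := by positivity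
    linarith
  have hdsmall : 2 / (d : ℝ) ≤ 1 / 10 ^ 6 := by
    have h1 : (10 : ℝ) ^ 4 * 10 ^ 4 ≤ σ * k := mul_le_mul hσ4 hk4 (by norm_num) hσ.le
    rw [hd2, div_le_div_iff₀ (by positivity) (by norm_num)]
    nlinarith
  have hScard : 10 ^ 7 ≤ (S.card : ℝ) := by
    have h1 : 7000 ≤ ε * σ := hεk.trans (by gcongr)
    have h2 : α ^ 2 * m ≤ α * m := by
      have : α * (α * m) ≤ 1 * (α * m) := by gcongr
      linarith
    rw [hS]
    nlinarith
  have hS0 : 0 < S.card := by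
    have : (0 : ℝ) < S.card := by linarith
    exact_mod_cast this
  set G : Set (EuclideanSpace ℝ (Fin d)) :=
    {θ | 11 / 10 * ε * (σ * k) * ‖θ‖ < inner ℝ θ μ} with hGdef
  have hG : MeasurableSet G := measurableSet_lt (by fun_prop) (by fun_prop)
  have hH : MeasurableSet {θ : EuclideanSpace ℝ (Fin d) | σ / 2 ≤ inner ℝ (dir θ) μ} :=
    measurableSet_le measurable_const (measurable_dir.inner measurable_const)
  have hrob : ∀ θ ∈ G, robustError μ σ ε (linearClassifier θ) ≤ ENNReal.ofReal (1 / 10 ^ 5) := by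
    intro θ hθ
    -- With this t the noise allowance tσ is a tenth of the attack allowance ε√d, and 1/t² ≤
    -- 100/7000².
    have ht : 0 < ε * k / 10 := by positivity
    refine (robustError_le hσ hε.le ht ?_).trans (ENNReal.ofReal_le_ofReal ?_)
    · rw [hσk]
      refine lt_of_eq_of_lt ?_ hθ
      ring
    · rw [div_le_div_iff₀ (by positivity) (by norm_num)]
      nlinarith
  have h1 := supervised_direction hd hk hσk hμ hσ4 hk4 (τ := σ / √n) (by positivity) hσn
  have h2 : ∀ θ ∈ {θ : EuclideanSpace ℝ (Fin d) | σ / 2 ≤ inner ℝ (dir θ) μ},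
      ((Measure.pi (coreLaw σ S)).prod (isoGaussian 0 (σ / √m))).real
        {p | signalCoeff μ θ p.1 • μ + dirCoeff μ θ p.1 • dir θ + perp (dir θ) p.2 ∉ G} ≤
      (400 / S.card + 1 / 100 ^ 2 + 1 / 100 ^ 2) + (2 / d + 1 / 100 ^ 2) := by
    intro θ hθ
    have hu := dir_eq_zero_or_norm θ
    have q1 := signalCoeff_deviation hσ hθ hS0
    have q2 := dirCoeff_lower_deviation hm μ θ (T := 100) hσ (by norm_num) S
    have q3 := abs_dirCoeff_deviation hm μ θ (T := 100) hσ (by norm_num) S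
    have g1 := isoGaussian_norm_sq_deviation hd L
    have g2 := isoGaussian_zero_inner_deviation (perp (dir θ) μ) (T := 100) (by norm_num) hL hD
      ((norm_perp_le hu μ).trans hμ.le)
    refine (prod_real_le _ _
      (A := {q | signalCoeff μ θ q < S.card / (4 * m)} ∪ {q | dirCoeff μ θ q < -(100 * (σ / √m))} ∪
        {q | 100 * σ < |dirCoeff μ θ q|})
      (B := {g | 2 * d * L ^ 2 < ‖g‖ ^ 2} ∪
        {g | 100 * (L * (σ * k)) < |inner ℝ (perp (dir θ) μ) g|}) fun p hp => ?_).trans ?_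
    · by_contra hcon
      simp only [Set.mem_union, Set.mem_ofPred_eq, not_or, not_lt] at hcon
      obtain ⟨⟨⟨c1, c2⟩, c3⟩, c4, c5⟩ := hcon
      refine hp (large_margin hu hk hε hε2 hσ hL hμ hkσ hα hαk hεk hLα ?_ ?_ c2 c3 ?_ c5)
      · have : σ / 2 ≤ inner ℝ (dir θ) μ := hθ
        linarith
      · refine le_of_eq_of_le ?_ c1
        rw [hS]
        field_simp
      · rwa [hd2] at c4
    · refine add_le_add ?_ ?_
      · refine (measureReal_union_le _ _).trans (add_le_add ?_ q3)
        exact (measureReal_union_le _ _).trans (add_le_add q1 q2)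
      · exact (measureReal_union_le _ _).trans (add_le_add g1 g2)
  refine (expectedRobustError_le hG hrob (selfTraining_failure_le hn hm μ σ S hG hH h1 h2)).trans ?_
  rw [← ENNReal.ofReal_add (by positivity) (by positivity),
    ← ENNReal.ofReal_add (by positivity) (by positivity)]
  refine ENNReal.ofReal_le_ofReal ?_
  have : 400 / (S.card : ℝ) ≤ 1 / 10 ^ 4 := by
    rw [div_le_div_iff₀ (by linarith) (by norm_num)]
    linarith
  linarith

/-- The mean enters only through its norm √d, and the bound |b| ≤ α needs no information on the
first stage, so every first-stage estimator is admitted. -/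
lemma expectedRobustError_lower {n m : ℕ} {μ : EuclideanSpace ℝ (Fin d)} {ε α σ k : ℝ}
    {S : Finset (Fin m)} (hd : 0 < d) (hn : 0 < n) (hm : 0 < m) (hε : 0 < ε) (hε2 : ε ≤ 1 / 2)
    (hα1 : α < 1) (hS : (S.card : ℝ) = α * m) (hk : 0 < k) (hσ : 0 < σ)
    (hσk : √(d : ℝ) = σ * k) (hμ : ‖μ‖ = σ * k) (hkσ : k ≤ σ)
    (hαk : 10 ^ 4 ≤ α * k) (hεk : 7000 ≤ ε * k) (hmα : α ^ 2 * m ≤ 1 / 10 ^ 4 * ε ^ 2 * σ ^ 2) :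
    ENNReal.ofReal (1 / 2) ≤ expectedRobustError μ σ ε n S := by
  have hm' : (0 : ℝ) < m := by exact_mod_cast hm
  have hsm : 0 < √(m : ℝ) := Real.sqrt_pos.2 hm'
  have hd2 : (d : ℝ) = (σ * k) ^ 2 := by rw [← hσk, Real.sq_sqrt (by positivity)]
  have hk4 : 10 ^ 4 ≤ k := hαk.trans (mul_le_of_le_one_left hk.le hα1.le)
  have hσ4 : 10 ^ 4 ≤ σ := hk4.trans hkσ
  have hD : 0 < σ * k := by positivity
  set L := σ / √m with hLdef
  have hL : 0 < L := by positivity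
  have hLα : α ≤ 1 / 100 * ε * L := by
    rw [hLdef, ← mul_div_assoc, le_div_iff₀ hsm]
    refine abs_le_of_sq_le_sq' ?_ (by positivity) |>.2
    rw [mul_pow, Real.sq_sqrt hm'.le]
    linarith
  have hdsmall : 1 / (d : ℝ) ≤ 1 / 10 ^ 6 := by
    have h1 : (10 : ℝ) ^ 4 * 10 ^ 4 ≤ σ * k := mul_le_mul hσ4 hk4 (by norm_num) hσ.le
    rw [hd2, div_le_div_iff₀ (by positivity) (by norm_num)]
    nlinarith
  set G : Set (EuclideanSpace ℝ (Fin d)) :=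
    {θ | 10 * σ * ‖θ‖ < ε * ∑ j, |θ j| - inner ℝ θ μ} with hGdef
  have hG : MeasurableSet G := measurableSet_lt (by fun_prop) (by fun_prop)
  have hrob : ∀ θ ∈ G, ENNReal.ofReal (1 - 1 / 10 ^ 2) ≤ robustError μ σ ε (linearClassifier θ) :=
    fun θ hθ => le_robustError hσ hε.le (by norm_num) hθ
  have h2 : ∀ θ ∈ (Set.univ : Set (EuclideanSpace ℝ (Fin d))),
      ((Measure.pi (coreLaw σ S)).prod (isoGaussian 0 (σ / √m))).real
        {p | signalCoeff μ θ p.1 • μ + dirCoeff μ θ p.1 • dir θ + perp (dir θ) p.2 ∉ G} ≤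
      (0 + 1 / 10 ^ 2) + (2 / d + 1 / 10 ^ 2 + 1 / 10 ^ 2 + 324 / d) := by
    intro θ _
    have hu := dir_eq_zero_or_norm θ
    have q1 : (Measure.pi (coreLaw σ S)).real {q | ¬ |signalCoeff μ θ q| ≤ S.card / m} ≤ 0 := by
      rw [measureReal_def, ae_iff.1 (abs_signalCoeff_le hm μ θ σ S), ENNReal.toReal_zero]
    have q2 := abs_dirCoeff_deviation hm μ θ (T := 10) hσ (by norm_num) S
    have g1 := isoGaussian_norm_sq_deviation hd L
    have g2 := isoGaussian_zero_inner_deviation (perp (dir θ) μ) (T := 10) (by norm_num) hL hD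
      ((norm_perp_le hu μ).trans hμ.le)
    have g3 := isoGaussian_zero_inner_deviation (dir θ) (T := 10) (by norm_num) hL one_pos
      (norm_dir_le_one θ)
    have g4 := isoGaussian_l1_deviation hd hL
    refine (prod_real_le _ _
      (A := {q | ¬ |signalCoeff μ θ q| ≤ S.card / m} ∪ {q | 10 * σ < |dirCoeff μ θ q|})
      (B := {g | 2 * d * L ^ 2 < ‖g‖ ^ 2} ∪
        {g | 10 * (L * (σ * k)) < |inner ℝ (perp (dir θ) μ) g|} ∪
        {g | 10 * (L * 1) < |inner ℝ (dir θ) g|} ∪ {g | ∑ j, |g j| < d * L / 2})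
      fun p hp => ?_).trans ?_
    · by_contra hcon
      simp only [Set.mem_union, Set.mem_ofPred_eq, not_or, not_lt, not_not, mul_one] at hcon
      obtain ⟨⟨c1, c2⟩, ⟨⟨c3, c4⟩, c5⟩, c6⟩ := hcon
      refine hp (small_margin hu hk hε hε2 hσ hL hσk (hμ.trans hσk.symm) hkσ hαk hεk hLα ?_ c2 ?_
        c4 c5 ?_)
      · rwa [hS, mul_div_cancel_right₀ _ hm'.ne'] at c1
      · rwa [hd2] at c3
      · rwa [hd2] at c6
    · refine add_le_add ?_ ?_
      · exact (measureReal_union_le _ _).trans (add_le_add q1 q2)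
      · refine (measureReal_union_le _ _).trans (add_le_add ?_ g4)
        refine (measureReal_union_le _ _).trans (add_le_add ?_ g3)
        exact (measureReal_union_le _ _).trans (add_le_add g1 g2)
  refine le_trans ?_ (le_expectedRobustError hG hrob
    (selfTraining_failure_le hn hm μ σ S hG MeasurableSet.univ (p₁ := 0) (by simp) h2))
  rw [ENNReal.ofReal_zero, zero_add, ← ENNReal.ofReal_one, ← ENNReal.ofReal_sub _ (by positivity),
    ← ENNReal.ofReal_mul (by norm_num)]
  -- Numerically 0.99 · (1 - 0.03 - 326/d) ≥ 1/2, since d ≥ 10⁶.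
  refine ENNReal.ofReal_le_ofReal ?_
  have h3 : 2 / (d : ℝ) = 2 * (1 / d) := by ring
  have h4 : 324 / (d : ℝ) = 324 * (1 / d) := by ring
  rw [h3, h4]
  linarith

lemma norm_allOnes (d : ℕ) : ‖allOnes d‖ = √d := by
  simp [allOnes, EuclideanSpace.norm_eq]


end SelfTraining

end

theorem mainTheorem3 :
    ∃ c r : ℝ, 0 < c ∧ 0 < r ∧
      ∀ (d n₀ n m : ℕ) (ε α σ : ℝ) (S : Finset (Fin m)),
        2 ≤ d → 1 ≤ n₀ → n₀ ≤ n → 1 ≤ m →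
        0 < ε → ε ≤ 1 / 2 → 0 < α → α < 1 →
        σ = ((n₀ : ℝ) * d) ^ (1 / 4 : ℝ) →
        (S.card : ℝ) = α * m →
        r < min (ε ^ 2 / Real.log d) (α ^ 2) * √((d : ℝ) / n₀) →
          (∀ μ : EuclideanSpace ℝ (Fin d), ‖μ‖ ^ 2 = d →
            (n₀ : ℝ) * (288 * ε ^ 2 / α ^ 2) * √((d : ℝ) / n₀) ≤ m →
              SelfTraining.expectedRobustError μ σ ε n S ≤ ENNReal.ofReal (1 / 1000)) ∧
          ((m : ℝ) ≤ (n₀ : ℝ) * (c * ε ^ 2 / α ^ 2) * √((d : ℝ) / n₀) →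
              ENNReal.ofReal (1 / 2 * (1 - 1 / (d : ℝ))) ≤
                SelfTraining.expectedRobustError (SelfTraining.allOnes d) σ ε n S) := by
  -- c = (1/100)² is what yields α ≤ εL/100 in the lower bound; r = (10⁴)² is what yields αk ≥ 10⁴.
  refine ⟨1 / 10 ^ 4, 10 ^ 8, by norm_num, by norm_num, ?_⟩
  intro d n₀ n m ε α σ S hd hn₀ hn hm hε hε2 hα hα1 hσ hS hr
  obtain ⟨k, hk, hσ0, hσk, hσ2, hK, hαk, hεk⟩ := SelfTraining.exists_scale hd hn₀ hε hα hσ hr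
  have hd0 : 0 < d := by omega
  have hn0 : 0 < n := by omega
  have hn₀' : (1 : ℝ) ≤ n₀ := by exact_mod_cast hn₀
  have hn' : (n₀ : ℝ) ≤ n := by exact_mod_cast hn
  have hkσ : k ≤ σ := by
    refine abs_le_of_sq_le_sq' ?_ hσ0.le |>.2
    rw [hσ2]
    exact le_mul_of_one_le_left (sq_nonneg k) hn₀'
  have hσn : σ / √n ≤ k := by
    have hn1 : (0 : ℝ) < n := by linarith
    refine abs_le_of_sq_le_sq' ?_ hk.le |>.2
    rw [div_pow, Real.sq_sqrt hn1.le, hσ2, div_le_iff₀ hn1, mul_comm]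
    gcongr
  rw [hK]
  refine ⟨fun μ hμ hle => ?_, fun hle => ?_⟩
  · have hμ' : ‖μ‖ = σ * k := by rw [← hσk, ← hμ, Real.sqrt_sq (norm_nonneg μ)]
    refine SelfTraining.expectedRobustError_upper hd0 hn0 hm hε hε2 hα hα1 hS hk hσ0 hσk hμ' hkσ
      hσn hαk hεk ?_
    have : (n₀ : ℝ) * (288 * ε ^ 2 / α ^ 2) * k ^ 2 = 288 * ε ^ 2 * σ ^ 2 / α ^ 2 := by
      rw [hσ2]; ring
    rw [this, div_le_iff₀ (by positivity)] at hle
    linarith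
  -- The bound obtained is 1/2, slightly more than claimed.
  · refine le_trans (ENNReal.ofReal_le_ofReal ?_) (SelfTraining.expectedRobustError_lower hd0 hn0 hm
      hε hε2 hα1 hS hk hσ0 hσk ((SelfTraining.norm_allOnes d).trans hσk) hkσ hαk hεk ?_)
    · have : 0 ≤ 1 / (d : ℝ) := by positivity
      linarith
    · have : (n₀ : ℝ) * (1 / 10 ^ 4 * ε ^ 2 / α ^ 2) * k ^ 2 =
          1 / 10 ^ 4 * ε ^ 2 * σ ^ 2 / α ^ 2 := by
        rw [hσ2]; ring
      rw [this, le_div_iff₀ (by positivity)] at hle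
      linarith
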